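/- Let $\mathbb G$ be a graded Lie group, that is, a connected and simply connected Lie group whose Lie algebra has a decomposition $\mathfrak g=\bigoplus_{i\ge 1}\mathfrak g_i$ with $[\mathfrak g_i,\mathfrak g_j]\subseteq\mathfrak g_{i+j}$, equipped with its dilations $D_r$ (the automorphisms of $\mathbb G$ whose differential is multiplication by $r^i$ on $\mathfrak g_i$) and a Haar measure. Let $\mathcal R$ be a positive Rockland operator of homogeneous degree $\nu\ge 2$ on $\mathbb G$: a left-invariant differential operator with $\mathcal R(f\circ D_r)=r^\nu(\mathcal Rf)\circ D_r$ for $r>0$ and $f\in C^\infty(\mathbb G)$, such that $\pi(\mathcal R)$ is injective on the smooth vectors of every nontrivial irreducible strongly continuous unitary representation $\pi$ of $\mathbb G$, and such that $\int_{\mathbb G}(\mathcal R\varphi)\overline{\varphi}\,dx\ge 0$ for all $\varphi\in C_c^\infty(\mathbb G)$. As usual, $\mathcal R$ is assumed to be essentially self-adjoint on $C_c^\infty(\mathbb G)\subset L^2(\mathbb G)$. Its powers are those of its self-adjoint closure, given by the spectral calculus. For $\sigma,\tau\in\mathbb R$ let $$H^\sigma=\{f\in\mathcal D'(\mathbb G):(I+\mathcal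 R)^{\sigma/\nu}f\in L^2(\mathbb G)\},\qquad \|f\|_{H^\sigma}=\|(I+\mathcal R)^{\sigma/\nu}f\|_{L^2},\qquad \|f\|_{\dot H^\tau}=\|\mathcal R^{\tau/\nu}f\|_{L^2},$$ and let $H^\sigma\cap\dot H^\tau$ be the space of all $f\in H^\sigma$ with $\mathcal R^{\tau/\nu}f\in L^2(\mathbb G)$, with norm $\|f\|_{H^\sigma\cap\dot H^\tau}=\|f\|_{H^\sigma}+\|f\|_{\dot H^\tau}$. Let $s\ge 0$ and $\gamma\in\mathbb R$ with $s+\gamma\ge 0$. Then there is a constant $C$, independent of $t$ and of the data, such that for all $(u_0,u_1)\in(H^s\cap\dot H^{-\gamma})\times(H^{s-1}\cap\dot H^{-\gamma})$ the linear Cauchy problem $$u_{tt}+\mathcal R u+u_t=0\quad(t>0),\qquad u(0)=u_0,\qquad u_t(0)=u_1$$ has a unique solution $u\in C([0,\infty);H^s)$ (the time derivatives and the equation being understood in the sense of distributions on $\mathbb G$, with $u$ weakly $C^1$ on $[0,\infty)$), and this solution satisfies, for all $t\ge 0$, $$\|u(t)\|_{\dot H^s}\le C\,(1+t)^{-\frac{s+\gamma}{\nu}}\left(\|u_0\|_{H^s\cap\dot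 H^{-\gamma}}+\|u_1\|_{H^{s-1}\cap\dot H^{-\gamma}}\right).$$ -/

import Mathlib

open MeasureTheory Set Filter Topology
open scoped Manifold ContDiff ENNReal InnerProductSpace

noncomputable section

namespace GradedLie

/-! ### Left-invariant differential operators on a Lie group -/

section Operators

variable (E : Type*) [NormedAddCommGroup E] [NormedSpace ℝ E]
  (G : Type*) [TopologicalSpace G] [ChartedSpace E G] [Group G]
  (F : Type*) [NormedAddCommGroup F] [NormedSpace ℂ F]

/-- The space `C^∞(G; F)` of smooth functions on `G` with values in a complex normed space. -/
def SmoothFun : Submodule ℂ (G → F) where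
  carrier := {f | ContMDiff 𝓘(ℝ, E) 𝓘(ℝ, F) ∞ f}
  add_mem' hf hg := hf.add hg
  zero_mem' := contMDiff_const
  smul_mem' c _ hf := by
    have h : ContDiff ℝ ∞ (fun x : F => c • x) := contDiff_const_smul c
    exact h.contMDiff.comp hf

/-- The space `C_c^∞(G; ℂ)` of test functions. -/
def TestFun : Submodule ℂ (SmoothFun E G ℂ) where
  carrier := {φ | HasCompactSupport (φ : G → ℂ)}
  add_mem' hf hg := HasCompactSupport.add hf hg
  zero_mem' := HasCompactSupport.zero
  smul_mem' c _ hf := HasCompactSupport.smul_left (f := fun _ => c) hf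

variable {E G F}

/-- The left-invariant vector field of `X`, evaluated on `f`: the derivative at `h = 1`, in the
direction `X`, of `h ↦ f (g h)`; that is, `(X f)(g) = d/dt f (g exp (t X))` at `t = 0`. -/
def leftDerivFun (X : GroupLieAlgebra 𝓘(ℝ, E) G) (f : G → F) (g : G) : F :=
  mfderiv 𝓘(ℝ, E) 𝓘(ℝ, F) (fun h => f (g * h)) 1 X

lemma support_leftDerivFun_subset [ContinuousMul G] (X : GroupLieAlgebra 𝓘(ℝ, E) G) (f : G → F) :
    Function.support (leftDerivFun X f) ⊆ tsupport f := by
  intro g hg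
  by_contra hgf
  refine hg ?_
  have h1 : f =ᶠ[𝓝 (g * 1)] 0 := by
    rw [mul_one]; exact notMem_tsupport_iff_eventuallyEq.mp hgf
  have h2 : (fun h => f (g * h)) =ᶠ[𝓝 (1 : G)] fun _ => (0 : F) :=
    (continuous_const_mul g).continuousAt.eventually h1
  unfold leftDerivFun
  rw [h2.mfderiv_eq, mfderiv_const]
  rfl

variable [LieGroup 𝓘(ℝ, E) ∞ G]

lemma contMDiff_leftDerivFun (X : GroupLieAlgebra 𝓘(ℝ, E) G) {f : G → F}
    (hf : ContMDiff 𝓘(ℝ, E) 𝓘(ℝ, F) ∞ f) :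
    ContMDiff 𝓘(ℝ, E) 𝓘(ℝ, F) ∞ (leftDerivFun X f) := by
  intro g₀
  have h1 : ContMDiff (𝓘(ℝ, E).prod 𝓘(ℝ, E)) 𝓘(ℝ, F) ∞
      (Function.uncurry fun g h : G => f (g * h)) := hf.comp (contMDiff_mul 𝓘(ℝ, E) ∞)
  have h2 := ContMDiffAt.mfderiv_apply (I := 𝓘(ℝ, E)) (I' := 𝓘(ℝ, F)) (J := 𝓘(ℝ, E))
    (J' := 𝓘(ℝ, E)) (x₀ := g₀) (m := ∞) (n := ∞)
    (fun g h : G => f (g * h)) (fun _ : G => (1 : G)) id (fun _ : G => (X : E))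
    h1.contMDiffAt contMDiffAt_const contMDiffAt_id contMDiffAt_const (by simp)
  have : IsManifold 𝓘(ℝ, E) 1 G := IsManifold.of_le (n := ∞) (by simp)
  refine h2.congr_of_eventuallyEq (Filter.Eventually.of_forall fun g => ?_)
  have h3 := inTangentCoordinates_eq (I := 𝓘(ℝ, E)) (I' := 𝓘(ℝ, F)) (fun _ : G => (1 : G))
    (fun g : G => f (g * 1))
    (fun g : G => (mfderiv 𝓘(ℝ, E) 𝓘(ℝ, F) (fun h => f (g * h)) 1 : E →L[ℝ] F))
    (x₀ := g₀) (x := g) (mem_chart_source E (1 : G)) (by rw [chartAt_self_eq]; trivial)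
  refine Eq.trans ?_ (congrArg (fun L : E →L[ℝ] F => L X) h3).symm
  have h4 : (tangentBundleCore 𝓘(ℝ, E) G).coordChange (achart E (1 : G)) (achart E (1 : G)) 1
      (X : E) = X :=
    (tangentBundleCore 𝓘(ℝ, E) G).coordChange_self (achart E (1 : G)) 1
      (mem_chart_source E (1 : G)) X
  rw [tangentBundleCore_coordChange_model_space]
  exact (congrArg (fun Y : E =>
    (mfderiv 𝓘(ℝ, E) 𝓘(ℝ, F) (fun h => f (g * h)) 1 : E →L[ℝ] F) Y) h4).symm

/-- A left-invariant vector field as a linear operator on `C^∞(G; F)`. -/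
def leftDeriv (X : GroupLieAlgebra 𝓘(ℝ, E) G) : SmoothFun E G F →ₗ[ℂ] SmoothFun E G F where
  toFun f := ⟨leftDerivFun X f, contMDiff_leftDerivFun X f.2⟩
  map_add' f₁ f₂ := by
    ext g
    have hm : ContMDiff 𝓘(ℝ, E) 𝓘(ℝ, E) ∞ (fun h : G => g * h) := contMDiff_mul_left
    have d₁ : MDifferentiableAt 𝓘(ℝ, E) 𝓘(ℝ, F) (fun h => (f₁ : G → F) (g * h)) 1 :=
      ((ContMDiff.comp f₁.2 hm).mdifferentiable (by simp)).mdifferentiableAt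
    have d₂ : MDifferentiableAt 𝓘(ℝ, E) 𝓘(ℝ, F) (fun h => (f₂ : G → F) (g * h)) 1 :=
      ((ContMDiff.comp f₂.2 hm).mdifferentiable (by simp)).mdifferentiableAt
    exact congrArg (fun L : E →L[ℝ] F => L X) (mfderiv_add d₁ d₂)
  map_smul' c f := by
    ext g
    have hm : ContMDiff 𝓘(ℝ, E) 𝓘(ℝ, E) ∞ (fun h : G => g * h) := contMDiff_mul_left
    have d : MDifferentiableAt 𝓘(ℝ, E) 𝓘(ℝ, F) (fun h => (f : G → F) (g * h)) 1 :=
      ((ContMDiff.comp f.2 hm).mdifferentiable (by simp)).mdifferentiableAt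
    have hc : HasMFDerivAt 𝓘(ℝ, F) 𝓘(ℝ, F) (fun x : F => c • x) ((f : G → F) (g * 1))
        (c • ContinuousLinearMap.id ℝ F) :=
      ((hasFDerivAt_id _).const_smul c).hasMFDerivAt
    exact congrArg (fun L : E →L[ℝ] F => L X) (hc.comp (1 : G) d.hasMFDerivAt).mfderiv

/-- The left-invariant differential operator given by a noncommutative polynomial `P`, with complex
coefficients, in left-invariant vector fields. Every left-invariant differential operator is of
this form. It acts on smooth functions with values in any complex normed space. -/
def diffOp (P : FreeAlgebra ℂ (GroupLieAlgebra 𝓘(ℝ, E) G)) :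
    SmoothFun E G F →ₗ[ℂ] SmoothFun E G F :=
  (FreeAlgebra.lift ℂ (A := Module.End ℂ (SmoothFun E G F)) fun X => leftDeriv X) P

lemma diffOp_mem_testFun [ContinuousMul G] (P : FreeAlgebra ℂ (GroupLieAlgebra 𝓘(ℝ, E) G)) :
    ∀ φ ∈ TestFun E G, diffOp P φ ∈ TestFun E G := by
  unfold diffOp
  induction P using FreeAlgebra.induction with
  | grade0 c =>
    intro φ hφ
    rw [AlgHom.commutes, Module.algebraMap_end_apply]
    exact (TestFun E G).smul_mem c hφ
  | grade1 X =>
    intro φ hφ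
    rw [FreeAlgebra.lift_ι_apply]
    exact HasCompactSupport.mono' (f := (φ : G → ℂ)) hφ (support_leftDerivFun_subset X _)
  | mul a b ha hb =>
    intro φ hφ
    rw [map_mul]
    exact ha _ (hb _ hφ)
  | add a b ha hb =>
    intro φ hφ
    rw [map_add]
    exact (TestFun E G).add_mem (ha _ hφ) (hb _ hφ)

/-- A left-invariant differential operator as an operator on `C_c^∞(G; ℂ)`. -/
def diffOpTest [ContinuousMul G] (P : FreeAlgebra ℂ (GroupLieAlgebra 𝓘(ℝ, E) G)) :
    TestFun E G →ₗ[ℂ] TestFun E G :=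
  (diffOp P).restrict (diffOp_mem_testFun P)

/-! ### Gradations, dilations, Rockland operators -/

/-- A gradation `𝔤 = ⨁_{i ≥ 1} 𝔤_i`, `[𝔤_i, 𝔤_j] ⊆ 𝔤_{i + j}`, of the Lie algebra of `G`. The index
`0` carries the zero space. -/
structure IsGradation (V : ℕ → Submodule ℝ (GroupLieAlgebra 𝓘(ℝ, E) G)) : Prop where
  zero : V 0 = ⊥
  isInternal : DirectSum.IsInternal V
  bracket_mem : ∀ i j, ∀ X ∈ V i, ∀ Y ∈ V j, ⁅X, Y⁆ ∈ V (i + j)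

/-- `D` is the group dilation `D_r = exp ∘ D_r^𝔤 ∘ exp⁻¹`: the smooth endomorphism of `G` whose
differential at the identity is multiplication by `r ^ i` on `𝔤_i`. For a graded Lie group it exists
and is unique. -/
def IsDilation (V : ℕ → Submodule ℝ (GroupLieAlgebra 𝓘(ℝ, E) G)) (r : ℝ) (D : G →* G) : Prop :=
  ContMDiff 𝓘(ℝ, E) 𝓘(ℝ, E) ∞ D ∧
    ∀ i, ∀ X ∈ V i, (mfderiv 𝓘(ℝ, E) 𝓘(ℝ, E) D 1 X : E) = r ^ i • (X : E)

/-- Homogeneity of degree `ν`: `R (f ∘ D_r) = r ^ ν (R f) ∘ D_r` for `r > 0`, `f ∈ C^∞(G)`. -/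
def IsHomogeneousOp (V : ℕ → Submodule ℝ (GroupLieAlgebra 𝓘(ℝ, E) G)) (ν : ℝ)
    (P : FreeAlgebra ℂ (GroupLieAlgebra 𝓘(ℝ, E) G)) : Prop :=
  ∀ r : ℝ, 0 < r → ∃ (D : G →* G) (hD : IsDilation V r D), ∀ f : SmoothFun E G ℂ, ∀ x : G,
    (diffOp P ⟨(f : G → ℂ) ∘ D, ContMDiff.comp f.2 hD.1⟩ : G → ℂ) x =
      ((r ^ ν : ℝ) : ℂ) * (diffOp P f : G → ℂ) (D x)

/-- Irreducibility of a unitary representation: the space is nonzero and has no closed invariant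
subspaces except `0` and itself. -/
def IsIrreducibleRep {H : Type*} [NormedAddCommGroup H] [InnerProductSpace ℂ H]
    (π : G →* (H ≃ₗᵢ[ℂ] H)) : Prop :=
  Nontrivial H ∧ ∀ W : Submodule ℂ H, IsClosed (W : Set H) → (∀ g, ∀ v ∈ W, π g v ∈ W) →
    W = ⊥ ∨ W = ⊤

/-- A Rockland operator of homogeneous degree `ν`: a left-invariant differential operator `R`,
homogeneous of degree `ν > 0`, such that `π(R)` is injective on the smooth vectors of every
nontrivial irreducible strongly continuous unitary representation `π`. For a smooth vector `v`,
`π(R) v` is the value at `1` of `R` applied to the smooth function `g ↦ π(g) v`, since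
`dπ(X) v` is the derivative of that function at `1` along `X`. (Irreducible representations of `G`
live on separable Hilbert spaces, so that Hilbert spaces in `Type` suffice.) -/
structure IsRockland (V : ℕ → Submodule ℝ (GroupLieAlgebra 𝓘(ℝ, E) G)) (ν : ℝ)
    (P : FreeAlgebra ℂ (GroupLieAlgebra 𝓘(ℝ, E) G)) : Prop where
  degree_pos : 0 < ν
  homogeneous : IsHomogeneousOp V ν P
  injective : ∀ (H : Type) [NormedAddCommGroup H] [InnerProductSpace ℂ H] [CompleteSpace H]
    (π : G →* (H ≃ₗᵢ[ℂ] H)), (∀ v, Continuous fun g => π g v) → IsIrreducibleRep π →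
    (∃ g, π g ≠ 1) → ∀ (v : H) (hv : (fun g => π g v) ∈ SmoothFun E G H),
      (diffOp P ⟨fun g => π g v, hv⟩ : G → H) 1 = 0 → v = 0

end Operators

/-! ### The operator on `L²(G)` -/

section L2

variable {E : Type*} [NormedAddCommGroup E] [NormedSpace ℝ E]
  {G : Type*} [TopologicalSpace G] [ChartedSpace E G] [Group G] [LieGroup 𝓘(ℝ, E) ∞ G]
  [IsTopologicalGroup G] [MeasurableSpace G] [BorelSpace G]

/-- Positivity: `∫ (R φ) φ̄ ≥ 0` for all test functions. -/
def IsPositiveOp (μ : Measure G) (P : FreeAlgebra ℂ (GroupLieAlgebra 𝓘(ℝ, E) G)) : Prop :=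
  ∀ φ : TestFun E G, ∃ c : ℝ, 0 ≤ c ∧
    ∫ x, (diffOpTest P φ : G → ℂ) x * (starRingEnd ℂ) ((φ : G → ℂ) x) ∂μ = (c : ℂ)

variable (μ : Measure G) [μ.IsHaarMeasure]

lemma memLp_testFun (φ : TestFun E G) : MemLp (φ : G → ℂ) 2 μ :=
  (ContMDiff.continuous φ.1.2).memLp_of_hasCompactSupport φ.2

/-- The embedding of `C_c^∞(G)` into `L²(G)`. -/
def testToL2 : TestFun E G →ₗ[ℂ] Lp ℂ 2 μ where
  toFun φ := (memLp_testFun μ φ).toLp _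
  map_add' _ _ := rfl
  map_smul' _ _ := rfl

lemma testToL2_injective : Function.Injective (testToL2 (E := E) μ) := by
  intro φ ψ h
  have h1 : ((φ : G → ℂ)) =ᵐ[μ] (ψ : G → ℂ) := 
    (MemLp.toLp_eq_toLp_iff (memLp_testFun μ φ) (memLp_testFun μ ψ)).mp h
  have h2 := (Continuous.ae_eq_iff_eq μ (ContMDiff.continuous φ.1.2)
    (ContMDiff.continuous ψ.1.2)).mp h1
  exact Subtype.ext (Subtype.ext h2)

/-- The differential operator as an unbounded operator on `L²(G)` with domain `C_c^∞(G)`. -/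
def minimalOp (P : FreeAlgebra ℂ (GroupLieAlgebra 𝓘(ℝ, E) G)) : Lp ℂ 2 μ →ₗ.[ℂ] Lp ℂ 2 μ where
  domain := LinearMap.range (testToL2 (E := E) μ)
  toFun := testToL2 μ ∘ₗ diffOpTest P ∘ₗ
    (LinearEquiv.ofInjective (testToL2 (E := E) μ) (testToL2_injective μ)).symm.toLinearMap

end L2

/-! ### Fractional powers of a nonnegative self-adjoint operator -/

section Powers

variable {H : Type*} [NormedAddCommGroup H] [InnerProductSpace ℂ H] [CompleteSpace H]

open Classical in
/-- The bounded operator `(I + A)⁻¹` (zero if there is none). -/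
def resolvent (A : H →ₗ.[ℂ] H) : H →L[ℂ] H :=
  if h : ∃ T : H →L[ℂ] H, ∀ f, (T f, f - T f) ∈ A.graph then h.choose else 0

/-- `(I + A) ^ (-p)` for `p ≥ 0`, by the continuous functional calculus of `(I + A)⁻¹`. -/
def resolventPow (A : H →ₗ.[ℂ] H) (p : ℝ) : H →L[ℂ] H :=
  cfc (fun t : ℝ => t ^ p) (resolvent A)

/-- `(A (I + A)⁻¹) ^ p` for `p ≥ 0`; note that `A (I + A)⁻¹ = I - (I + A)⁻¹`. -/
def bddTransformPow (A : H →ₗ.[ℂ] H) (p : ℝ) : H →L[ℂ] H :=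
  cfc (fun t : ℝ => (1 - t) ^ p) (resolvent A)

/-- `g = A ^ a (I + A) ^ b f`, for real `a`, `b`, a nonnegative self-adjoint operator `A` and
`f`, `g` in the Hilbert space. With `T = (I + A)⁻¹` and `S = A (I + A)⁻¹` one has
`A ^ a (I + A) ^ b = S ^ a T ^ (-(a + b))`; the factors with negative exponents, which are
unbounded, are moved to the side of `g`. -/
def IsPower (A : H →ₗ.[ℂ] H) (a b : ℝ) (f g : H) : Prop :=
  bddTransformPow A (max (-a) 0) (resolventPow A (max (a + b) 0) g) =
    bddTransformPow A (max a 0) (resolventPow A (max (-(a + b)) 0) f)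

end Powers

/-! ### Distributions, Sobolev spaces, the Cauchy problem -/

section Sobolev

variable (E : Type*) [NormedAddCommGroup E] [NormedSpace ℝ E]
  (G : Type*) [TopologicalSpace G] [ChartedSpace E G] [Group G] [LieGroup 𝓘(ℝ, E) ∞ G]
  [IsTopologicalGroup G]

/-- Distributions on `G`, as (sequentially) continuous conjugate-linear functionals on
`C_c^∞(G)`: a locally integrable `f` acts by `φ ↦ ∫ f φ̄`. A sequence of test functions tends to zero
if the supports stay in a compact set and all left-invariant derivatives tend to zero uniformly. -/
def Dist : Type _ :=
  {f : TestFun E G →ₗ⋆[ℂ] ℂ // ∀ (K : Set G) (φ : ℕ → TestFun E G), IsCompact K →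
    (∀ n, tsupport (φ n : G → ℂ) ⊆ K) →
    (∀ Q : FreeAlgebra ℂ (GroupLieAlgebra 𝓘(ℝ, E) G),
      TendstoUniformly (fun n => (diffOpTest Q (φ n) : G → ℂ)) 0 atTop) →
    Tendsto (fun n => f (φ n)) atTop (𝓝 0)}

variable {E G}

instance : CoeFun (Dist E G) fun _ => TestFun E G → ℂ := ⟨fun f => f.1⟩

variable [MeasurableSpace G] [BorelSpace G]
  (μ : Measure G) [μ.IsHaarMeasure] (P : FreeAlgebra ℂ (GroupLieAlgebra 𝓘(ℝ, E) G)) (ν : ℝ)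

/-- The closure `R₂` of the differential operator in `L²(G)`, again written `R`. -/
def closedOp : Lp ℂ 2 μ →ₗ.[ℂ] Lp ℂ 2 μ := (minimalOp μ P).closure

/-- `(I + R) ^ (σ / ν) f = h ∈ L²(G)` for a distribution `f`; that is, `f = (I + R) ^ (-σ / ν) h` in
the sense of distributions: `f(φ) = ⟪(I + R) ^ (-σ / ν) φ, h⟫` for all test functions `φ`. -/
def SobolevRep (σ : ℝ) (f : Dist E G) (h : Lp ℂ 2 μ) : Prop :=
  ∀ φ : TestFun E G, ∃ ψ : Lp ℂ 2 μ,
    IsPower (closedOp μ P) 0 (-σ / ν) (testToL2 μ φ) ψ ∧ f φ = ⟪ψ, h⟫_ℂ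

/-- `R ^ (τ / ν) f = g ∈ L²(G)` for a distribution `f` in `H^σ(G)`; that is,
`g = R ^ (τ / ν) (I + R) ^ (-σ / ν) h` with `h = (I + R) ^ (σ / ν) f`. -/
def HomSobolevRep (σ τ : ℝ) (f : Dist E G) (g : Lp ℂ 2 μ) : Prop :=
  ∃ h, SobolevRep μ P ν σ f h ∧ IsPower (closedOp μ P) (τ / ν) (-σ / ν) h g

/-- The norm `‖f‖_{H^σ} = ‖(I + R) ^ (σ / ν) f‖_{L²}`, equal to `∞` unless `f ∈ H^σ(G)`. -/
def sobolevNorm (σ : ℝ) (f : Dist E G) : ℝ≥0∞ :=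
  ⨅ (h : Lp ℂ 2 μ) (_ : SobolevRep μ P ν σ f h), ‖h‖ₑ

/-- The homogeneous norm `‖f‖_{Ḣ^τ} = ‖R ^ (τ / ν) f‖_{L²}` on `H^σ(G)`, equal to `∞` unless
`f` lies in `H^σ(G) ∩ Ḣ^τ(G)`. -/
def homSobolevNorm (σ τ : ℝ) (f : Dist E G) : ℝ≥0∞ :=
  ⨅ (g : Lp ℂ 2 μ) (_ : HomSobolevRep μ P ν σ τ f g), ‖g‖ₑ

/-- The norm of `H^σ(G) ∩ Ḣ^τ(G)`, equal to `∞` outside of this space. -/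
def interNorm (σ τ : ℝ) (f : Dist E G) : ℝ≥0∞ :=
  sobolevNorm μ P ν σ f + homSobolevNorm μ P ν σ τ f

/-- `u` is a solution in `C([0, ∞); H^s(G))` of `u_tt + R u + u_t = 0` for `t > 0`, `u(0) = u₀`,
`u_t(0) = u₁`, where time derivatives and the equation are understood in the sense of distributions
on `G`, and `(R u)(φ) = u(R φ)`, as the positive operator `R` is formally self-adjoint. The function
`w` is `t ↦ u_t(t)(φ)`. -/
structure IsSolution (s : ℝ) (u₀ u₁ : Dist E G) (u : ℝ → Dist E G) : Prop where
  continuous : ∃ v : ℝ → Lp ℂ 2 μ, ContinuousOn v (Ici 0) ∧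
    ∀ t, 0 ≤ t → SobolevRep μ P ν s (u t) (v t)
  init : u 0 = u₀
  equation : ∀ φ : TestFun E G, ∃ w : ℝ → ℂ, ContinuousOn w (Ici 0) ∧
    (∀ t, 0 ≤ t → HasDerivWithinAt (fun τ => u τ φ) (w t) (Ici 0) t) ∧ w 0 = u₁ φ ∧
    ∀ t, 0 < t → HasDerivAt w (-(u t (diffOpTest P φ)) - w t) t

end Sobolev

end GradedLie

end

/-!
The statement is reduced to the functional calculus of one bounded operator. Let `A ≥ 0` be the
self-adjoint closure of `R` on `L²(G)`, `T = (I + A)⁻¹` and `S = I - T = A (I + A)⁻¹`. Then `T` is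
injective with spectrum in `[0, 1]`; its spectral variable `τ` corresponds to the spectral variable
`l = (1 - τ) / τ` of `A`.

*Calculus.* The multipliers of the damped wave equation oscillate like `cos (t √l)` for large `l`;
they are bounded and continuous in `τ ∈ (0, 1]` but have no limit at `τ = 0`, so that they
are not covered by the continuous functional calculus of `T`. For such a multiplier `m`, the
function `τ m(τ)` is continuous on `[0, 1]` and `‖(τ m)(T) f‖ ≤ sup |m| ‖T f‖`; so
`T f ↦ (τ m)(T) f` extends from the dense range of `T` to a bounded operator `multOp T m`.

*Scalar equation.* The solutions of `y'' + y' + l y = 0` are estimated through the energy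
`y'² + y y' + (l + 1/2) y²`, which decays like `exp (-(2/3) (1 - τ) t)`, uniformly in `l ≥ 0`
(`osc_energy_le`). With `y₀`, `y₁` the solutions for the data `(1, 0)`, `(0, 1)` this gives
`|y₀| ≤ 2 exp (-(1 - τ) t / 3)` and `|y₁| ≤ 2 τ ^ (1/2) exp (-(1 - τ) t / 3)`. Since `1 / ν ≤ 1/2`,
`y₁ τ ^ (-1/ν)` is a multiplier, and the solution is, in terms of `h₀ = (I + A) ^ (s/ν) u₀` and
`h₁ = (I + A) ^ ((s-1)/ν) u₁`,
`(I + A) ^ (s/ν) u(t) = y₀(t)(T) h₀ + (y₁(t) τ ^ (-1/ν))(T) h₁`.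

*Decay.* With `p = (s + γ) / ν`, write `1 = α τ ^ p + α (1 - τ) ^ p`, `α` bounded. The first part of
`S ^ (s/ν) (y τ ^ (-θ))(T) h` is rewritten in terms of the `Ḣ^{-γ}` datum, and the second one is a
bounded function of `h`; both then carry the factor `(1 - τ) ^ p exp (-(1 - τ) t / 3)`, which is
`O((1 + t) ^ (-p))` (`norm_bddTransformPow_propagator_le`).

*Equation and uniqueness.* A test function `φ` equals `T ^ 3 (I + R) ^ 3 φ`, and after the factor
`T ^ 3` the propagator is twice differentiable in `t` in the strong operator topology. For
uniqueness, the difference `U` of two solutions (as an `L²`-valued function) is integrated twice: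
`Y'' = U`, tested on a core, satisfies `T Y'' + T Y' + S Y = 0` with zero data, and the energy
`⟪T Y', Y'⟫ + ⟪S Y, Y⟫` does not increase (`weak_uniqueness`).
-/

noncomputable section

namespace GradedLie

/-! ### The resolvent of a nonnegative self-adjoint operator -/

section Resolvent

variable {H : Type*} [NormedAddCommGroup H] [InnerProductSpace ℂ H] [CompleteSpace H]

/-- The properties of `T = (I + A)⁻¹`, for a nonnegative self-adjoint operator `A`, on which the
functional calculus below rests: `T` is self-adjoint and injective, with spectrum in `[0, 1]`. -/
structure IsInjectiveContraction (T : H →L[ℂ] H) : Prop where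
  isSelfAdjoint : IsSelfAdjoint T
  spectrum_subset : spectrum ℝ T ⊆ Icc 0 1
  injective : ∀ x, T x = 0 → x = 0

variable {A : H →ₗ.[ℂ] H}

omit [CompleteSpace H] in
lemma norm_le_norm_add_of_mem_graph (hpos : ∀ x y, (x, y) ∈ A.graph → 0 ≤ (⟪x, y⟫_ℂ).re)
    {x y : H} (h : (x, y) ∈ A.graph) : ‖x‖ ≤ ‖x + y‖ := by
  have h1 := hpos x y h
  have h2 := norm_add_sq (𝕜 := ℂ) x y
  have h3 : 0 ≤ RCLike.re ⟪x, y⟫_ℂ := h1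
  nlinarith [norm_nonneg x, norm_nonneg (x + y), sq_nonneg ‖y‖]

omit [CompleteSpace H] in
lemma eq_zero_of_add_eq_zero_of_mem_graph
    (hpos : ∀ x y, (x, y) ∈ A.graph → 0 ≤ (⟪x, y⟫_ℂ).re)
    {x y : H} (h : (x, y) ∈ A.graph) (hxy : x + y = 0) : x = 0 := by
  have := norm_le_norm_add_of_mem_graph hpos h
  rw [hxy, norm_zero] at this
  exact norm_le_zero_iff.mp this

lemma inner_symm_of_mem_graph (hA : IsSelfAdjoint A) {x y x' y' : H} (h : (x, y) ∈ A.graph)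
    (h' : (x', y') ∈ A.graph) : ⟪y, x'⟫_ℂ = ⟪x, y'⟫_ℂ := by
  rw [LinearPMap.mem_graph_iff] at h h'
  obtain ⟨a, rfl, rfl⟩ := h
  obtain ⟨b, rfl, rfl⟩ := h'
  have h1 := LinearPMap.adjoint_isFormalAdjoint hA.dense_domain
  rw [LinearPMap.isSelfAdjoint_def.mp hA] at h1
  exact h1 a b

/-- A vector orthogonal to the range of `I + A` is zero. -/
lemma eq_zero_of_orthogonal_add (hA : IsSelfAdjoint A)
    (hpos : ∀ x y, (x, y) ∈ A.graph → 0 ≤ (⟪x, y⟫_ℂ).re) {k : H}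
    (hk : ∀ x y, (x, y) ∈ A.graph → ⟪x + y, k⟫_ℂ = 0) : k = 0 := by
  -- such a `k` lies in the domain of the adjoint, which is `A`, and `A k = -k`
  have h1 : (k, -k) ∈ A.graph := by
    have h2 := LinearPMap.adjoint_graph_eq_graph_adjoint hA.dense_domain
    rw [LinearPMap.isSelfAdjoint_def.mp hA] at h2
    rw [h2, Submodule.mem_adjoint_iff]
    intro a b hab
    have h3 := hk a b hab
    rw [inner_add_left] at h3
    rw [inner_neg_right, sub_neg_eq_add, add_comm]
    exact h3
  exact eq_zero_of_add_eq_zero_of_mem_graph hpos h1 (add_neg_cancel k)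

lemma exists_resolvent (hA : IsSelfAdjoint A)
    (hpos : ∀ x y, (x, y) ∈ A.graph → 0 ≤ (⟪x, y⟫_ℂ).re) :
    ∃ T : H →L[ℂ] H, ∀ f, (T f, f - T f) ∈ A.graph := by
  let e : A.domain →ₗ[ℂ] H := A.domain.subtype + A.toFun
  have he : ∀ x : A.domain, e x = x + A x := fun x => rfl
  have hdense : DenseRange e := by
    have h1 : (LinearMap.range e).topologicalClosure = ⊤ := by
      rw [Submodule.topologicalClosure_eq_top_iff, Submodule.eq_bot_iff]
      intro k hk
      refine eq_zero_of_orthogonal_add hA hpos fun x y hxy => ?_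
      rw [LinearPMap.mem_graph_iff] at hxy
      obtain ⟨a, rfl, rfl⟩ := hxy
      exact hk _ ⟨a, rfl⟩
    exact (Submodule.dense_iff_topologicalClosure_eq_top).mpr h1
  have hnorm : ∀ x : A.domain, ‖A.domain.subtype x‖ ≤ 1 * ‖e x‖ := fun x => by
    rw [one_mul]
    exact norm_le_norm_add_of_mem_graph hpos (A.mem_graph x)
  refine ⟨A.domain.subtype.extendOfNorm e, fun f => ?_⟩
  have hclosed : IsClosed {f : H | (A.domain.subtype.extendOfNorm e f,
      f - A.domain.subtype.extendOfNorm e f) ∈ A.graph} := by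
    have h1 : IsClosed (A.graph : Set (H × H)) := hA.isClosed
    exact h1.preimage (by fun_prop)
  refine hdense.induction_on (p := fun f => (A.domain.subtype.extendOfNorm e f,
      f - A.domain.subtype.extendOfNorm e f) ∈ A.graph) f hclosed fun x => ?_
  rw [LinearMap.extendOfNorm_eq hdense ⟨1, hnorm⟩, he]
  simp

lemma resolvent_mem_graph (hA : IsSelfAdjoint A)
    (hpos : ∀ x y, (x, y) ∈ A.graph → 0 ≤ (⟪x, y⟫_ℂ).re) (f : H) :
    (resolvent A f, f - resolvent A f) ∈ A.graph := by
  have h := exists_resolvent hA hpos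
  rw [resolvent, dif_pos h]
  exact h.choose_spec f

lemma resolvent_add_of_mem_graph (hA : IsSelfAdjoint A)
    (hpos : ∀ x y, (x, y) ∈ A.graph → 0 ≤ (⟪x, y⟫_ℂ).re) {x y : H} (h : (x, y) ∈ A.graph) :
    resolvent A (x + y) = x := by
  have h1 := A.graph.sub_mem (resolvent_mem_graph hA hpos (x + y)) h
  refine sub_eq_zero.mp (eq_zero_of_add_eq_zero_of_mem_graph hpos h1 ?_)
  generalize resolvent A (x + y) = w
  change w - x + (x + y - w - y) = 0
  abel

lemma isInjectiveContraction_resolvent (hA : IsSelfAdjoint A)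
    (hpos : ∀ x y, (x, y) ∈ A.graph → 0 ≤ (⟪x, y⟫_ℂ).re) :
    IsInjectiveContraction (resolvent A) := by
  have hg := resolvent_mem_graph hA hpos
  set T := resolvent A
  have hsymm : ∀ f g, ⟪T f, g⟫_ℂ = ⟪f, T g⟫_ℂ := by
    intro f g
    have h1 := inner_symm_of_mem_graph hA (hg f) (hg g)
    rw [inner_sub_left, inner_sub_right] at h1
    linear_combination -h1
  have hT0 : 0 ≤ T := by
    rw [ContinuousLinearMap.nonneg_iff_isPositive]
    refine ⟨hsymm, fun f => ?_⟩
    have h1 := hpos _ _ (hg f)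
    have h2 : ⟪T f, f⟫_ℂ = ⟪T f, T f⟫_ℂ + ⟪T f, f - T f⟫_ℂ := by rw [← inner_add_right]; simp
    change 0 ≤ (⟪T f, f⟫_ℂ).re
    rw [h2, Complex.add_re]
    have h3 : 0 ≤ (⟪T f, T f⟫_ℂ).re := inner_self_nonneg (𝕜 := ℂ) (x := T f)
    positivity
  have hT1 : T ≤ 1 := by
    rw [ContinuousLinearMap.le_def]
    refine ⟨fun f g => ?_, fun f => ?_⟩
    · have h1 := hsymm f g
      change ⟪f - T f, g⟫_ℂ = ⟪f, g - T g⟫_ℂ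
      rw [inner_sub_left, inner_sub_right, h1]
    · have h1 := hpos _ _ (hg f)
      change 0 ≤ (⟪f - T f, f⟫_ℂ).re
      have h2 : ⟪f - T f, f⟫_ℂ = ⟪f - T f, f - T f⟫_ℂ + ⟪f - T f, T f⟫_ℂ := by
        rw [← inner_add_right, sub_add_cancel]
      have h3 : 0 ≤ (⟪f - T f, f - T f⟫_ℂ).re := inner_self_nonneg (𝕜 := ℂ) (x := f - T f)
      have h4 : (⟪f - T f, T f⟫_ℂ).re = (⟪T f, f - T f⟫_ℂ).re :=
        inner_re_symm (𝕜 := ℂ) _ _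
      rw [h2, Complex.add_re, h4]
      positivity
  have hsa : IsSelfAdjoint T := .of_nonneg hT0
  refine ⟨hsa, fun x hx => ⟨spectrum_nonneg_of_nonneg hT0 hx, ?_⟩, fun x hx => ?_⟩
  · exact (le_algebraMap_iff_spectrum_le (R := ℝ) (r := 1) (a := T)).mp (by simpa using hT1) x hx
  · have h1 := hg x
    rw [hx, sub_zero] at h1
    exact A.graph_fst_eq_zero_snd h1 rfl

end Resolvent

/-! ### Bounded continuous functions on `(0, 1]` of a contraction -/

section Calculus

variable {H : Type*} [NormedAddCommGroup H] [InnerProductSpace ℂ H] [CompleteSpace H]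

/-- A bounded continuous function on `(0, 1]`. It need not extend continuously to `0`: in terms of
the spectral variable `λ` of `A`, with `τ = (1 + λ)⁻¹`, it may oscillate as `λ → ∞`. -/
def IsMultiplier (m : ℝ → ℝ) : Prop :=
  ContinuousOn m (Ioc 0 1) ∧ ∃ C, ∀ τ ∈ Ioc (0 : ℝ) 1, |m τ| ≤ C

lemma IsMultiplier.continuousOn_mul {m : ℝ → ℝ} (hm : IsMultiplier m) :
    ContinuousOn (fun τ => τ * m τ) (Icc 0 1) := by
  obtain ⟨hc, C, hC⟩ := hm
  intro τ hτ
  rcases hτ.1.eq_or_lt with rfl | h0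
  · have h1 : Tendsto (fun τ : ℝ => |C| * |τ|) (𝓝[Icc 0 1] 0) (𝓝 0) := by
      have : Continuous fun τ : ℝ => |C| * |τ| := by fun_prop
      simpa using (this.tendsto 0).mono_left nhdsWithin_le_nhds
    refine ContinuousWithinAt.congr_of_eventuallyEq (f := fun τ => τ * m τ) ?_
      (Eventually.of_forall fun _ => rfl) rfl
    rw [ContinuousWithinAt, zero_mul]
    refine squeeze_zero_norm' ?_ h1
    filter_upwards [self_mem_nhdsWithin] with τ hτ
    rcases hτ.1.eq_or_lt with rfl | h0
    · simp
    · rw [Real.norm_eq_abs, abs_mul, mul_comm]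
      exact mul_le_mul_of_nonneg_right ((hC τ ⟨h0, hτ.2⟩).trans (le_abs_self C)) (abs_nonneg τ)
  · have h1 : ContinuousWithinAt m (Icc 0 1) τ := by
      refine (hc τ ⟨h0, hτ.2⟩).mono_of_mem_nhdsWithin ?_
      rw [mem_nhdsWithin_iff_eventually]
      filter_upwards [lt_mem_nhds h0] with x hx hx'
      exact ⟨hx, hx'.2⟩
    exact continuousWithinAt_id.mul h1

lemma IsMultiplier.of_continuousOn {m : ℝ → ℝ} (hm : ContinuousOn m (Icc 0 1)) :
    IsMultiplier m := by
  refine ⟨hm.mono Ioc_subset_Icc_self, ?_⟩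
  obtain ⟨C, hC⟩ := isCompact_Icc.exists_bound_of_continuousOn hm
  exact ⟨C, fun τ hτ => hC τ (Ioc_subset_Icc_self hτ)⟩

lemma IsMultiplier.mul {m n : ℝ → ℝ} (hm : IsMultiplier m) (hn : IsMultiplier n) :
    IsMultiplier fun τ => m τ * n τ := by
  obtain ⟨hc, C, hC⟩ := hm
  obtain ⟨hc', C', hC'⟩ := hn
  refine ⟨hc.mul hc', C * C', fun τ hτ => ?_⟩
  rw [abs_mul]
  exact mul_le_mul (hC τ hτ) (hC' τ hτ) (abs_nonneg _) ((abs_nonneg _).trans (hC τ hτ))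

lemma IsMultiplier.add {m n : ℝ → ℝ} (hm : IsMultiplier m) (hn : IsMultiplier n) :
    IsMultiplier fun τ => m τ + n τ := by
  obtain ⟨hc, C, hC⟩ := hm
  obtain ⟨hc', C', hC'⟩ := hn
  exact ⟨hc.add hc', C + C', fun τ hτ =>
    (abs_add_le _ _).trans (add_le_add (hC τ hτ) (hC' τ hτ))⟩

lemma IsMultiplier.const_mul {m : ℝ → ℝ} (c : ℝ) (hm : IsMultiplier m) :
    IsMultiplier fun τ => c * m τ :=
  (IsMultiplier.of_continuousOn continuousOn_const).mul hm

/-- `m(T)` for a multiplier `m`: the bounded extension of `T f ↦ (τ m(τ))(T) f` from the dense range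
of `T`. The function `τ ↦ τ m(τ)` is continuous on the spectrum, so that the continuous functional
calculus applies to it. -/
def multOp (T : H →L[ℂ] H) (m : ℝ → ℝ) : H →L[ℂ] H :=
  ((cfc (fun τ : ℝ => τ * m τ) T : H →L[ℂ] H) : H →ₗ[ℂ] H).extendOfNorm (T : H →ₗ[ℂ] H)

namespace IsInjectiveContraction

variable {T : H →L[ℂ] H} (hT : IsInjectiveContraction T)

include hT

lemma cfc_mul_apply {f g : ℝ → ℝ} (hf : ContinuousOn f (Icc 0 1)) (hg : ContinuousOn g (Icc 0 1))
    (x : H) : cfc (fun τ => f τ * g τ) T x = cfc f T (cfc g T x) := by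
  rw [cfc_mul f g T (hf.mono hT.spectrum_subset) (hg.mono hT.spectrum_subset)]
  rfl

lemma cfc_add_apply {f g : ℝ → ℝ} (hf : ContinuousOn f (Icc 0 1)) (hg : ContinuousOn g (Icc 0 1))
    (x : H) : cfc (fun τ => f τ + g τ) T x = cfc f T x + cfc g T x := by
  rw [cfc_add T f g (hf.mono hT.spectrum_subset) (hg.mono hT.spectrum_subset)]
  rfl

lemma cfc_congr_Icc {f g : ℝ → ℝ} (h : ∀ τ ∈ Icc (0 : ℝ) 1, f τ = g τ) : cfc f T = cfc g T :=
  cfc_congr fun τ hτ => h τ (hT.spectrum_subset hτ)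

lemma cfc_id_apply (x : H) : cfc (fun τ : ℝ => τ) T x = T x := by
  rw [cfc_id' ℝ T hT.isSelfAdjoint]

lemma cfc_one_sub_apply (x : H) : cfc (fun τ : ℝ => 1 - τ) T x = x - T x := by
  have h : cfc (fun τ : ℝ => 1 - τ) T = 1 - T := by
    rw [cfc_sub (fun _ => (1 : ℝ)) (fun τ => τ) T, cfc_id' ℝ T hT.isSelfAdjoint,
      cfc_const_one ℝ T hT.isSelfAdjoint]
  rw [h]
  rfl

omit hT in
lemma inner_cfc (f : ℝ → ℝ) (x y : H) : ⟪cfc f T x, y⟫_ℂ = ⟪x, cfc f T y⟫_ℂ := by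
  have h : IsSelfAdjoint (cfc f T) := cfc_predicate f T
  exact h.isSymmetric x y

lemma norm_cfc_apply_le {f g : ℝ → ℝ} (hf : ContinuousOn f (Icc 0 1))
    (hg : ContinuousOn g (Icc 0 1)) (h : ∀ τ ∈ Icc (0 : ℝ) 1, |f τ| ≤ |g τ|) (x : H) :
    ‖cfc f T x‖ ≤ ‖cfc g T x‖ := by
  have key : ∀ {f : ℝ → ℝ}, ContinuousOn f (Icc 0 1) →
      (⟪cfc (fun τ => f τ * f τ) T x, x⟫_ℂ).re = ‖cfc f T x‖ ^ 2 := by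
    intro f hf
    rw [hT.cfc_mul_apply hf hf, inner_cfc]
    exact inner_self_eq_norm_sq (𝕜 := ℂ) _
  have hle : cfc (fun τ => f τ * f τ) T ≤ cfc (fun τ => g τ * g τ) T := by
    refine cfc_mono (fun τ hτ => ?_) ((hf.mul hf).mono hT.spectrum_subset)
      ((hg.mul hg).mono hT.spectrum_subset)
    have := h τ (hT.spectrum_subset hτ)
    rw [← abs_mul_abs_self (f τ), ← abs_mul_abs_self (g τ)]
    gcongr
  rw [ContinuousLinearMap.le_def] at hle
  have h1 : 0 ≤ (⟪cfc (fun τ => g τ * g τ) T x - cfc (fun τ => f τ * f τ) T x, x⟫_ℂ).re :=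
    hle.2 x
  rw [inner_sub_left, Complex.sub_re, key hf, key hg] at h1
  nlinarith [norm_nonneg (cfc f T x), norm_nonneg (cfc g T x)]

lemma norm_cfc_apply_le_const {f : ℝ → ℝ} (hf : ContinuousOn f (Icc 0 1)) {C : ℝ}
    (h : ∀ τ ∈ Icc (0 : ℝ) 1, |f τ| ≤ C) (x : H) : ‖cfc f T x‖ ≤ C * ‖x‖ := by
  have hC : 0 ≤ C := (abs_nonneg _).trans (h 0 (by simp))
  refine (hT.norm_cfc_apply_le hf (g := fun _ => C) continuousOn_const
    (fun τ hτ => (h τ hτ).trans (le_abs_self C)) x).trans ?_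
  rw [cfc_const C T hT.isSelfAdjoint, Algebra.algebraMap_eq_smul_one]
  simp [norm_smul, abs_of_nonneg hC]

/-- The powers `T ^ p`, `p ≥ 0`, are injective, as `T ^ p` is a factor of a natural power of `T`. -/
lemma eq_zero_of_cfc_rpow_eq_zero {p : ℝ} (hp : 0 ≤ p) {x : H}
    (h : cfc (fun τ : ℝ => τ ^ p) T x = 0) : x = 0 := by
  have hn : ∀ n : ℕ, ∀ y, cfc (fun τ : ℝ => τ ^ n) T y = 0 → y = 0 := by
    intro n
    induction n with
    | zero =>
      intro y hy
      simpa [cfc_const_one ℝ T hT.isSelfAdjoint] using hy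
    | succ n ih =>
      intro y hy
      simp_rw [pow_succ] at hy
      rw [hT.cfc_mul_apply (by fun_prop) (by fun_prop), hT.cfc_id_apply] at hy
      exact hT.injective _ (ih _ hy)
  obtain ⟨n, hpn⟩ := exists_nat_ge p
  refine hn n x ?_
  have h1 : cfc (fun τ : ℝ => τ ^ n) T = cfc (fun τ : ℝ => τ ^ ((n : ℝ) - p) * τ ^ p) T := by
    refine hT.cfc_congr_Icc fun τ hτ => ?_
    rw [← Real.rpow_add_of_nonneg hτ.1 (by linarith) hp, sub_add_cancel, Real.rpow_natCast]
  rw [h1, hT.cfc_mul_apply, h, map_zero]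
  · exact (Real.continuous_rpow_const (by linarith)).continuousOn
  · exact (Real.continuous_rpow_const hp).continuousOn

lemma denseRange : DenseRange T := by
  have h1 : (LinearMap.range (T : H →ₗ[ℂ] H)).topologicalClosure = ⊤ := by
    rw [Submodule.topologicalClosure_eq_top_iff, Submodule.eq_bot_iff]
    intro k hk
    refine hT.injective k ?_
    have h2 : ⟪T (T k), k⟫_ℂ = 0 := hk _ ⟨T k, rfl⟩
    have h3 : ⟪T (T k), k⟫_ℂ = ⟪T k, T k⟫_ℂ := hT.isSelfAdjoint.isSymmetric _ _
    rw [h3] at h2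
    exact inner_self_eq_zero.mp h2
  exact (Submodule.dense_iff_topologicalClosure_eq_top).mpr h1

lemma clm_ext {B C : H →L[ℂ] H} (h : ∀ x, B (T x) = C (T x)) : B = C := by
  ext x
  exact congrFun (hT.denseRange.equalizer B.continuous C.continuous (funext h)) x

lemma norm_cfc_mul_le {m : ℝ → ℝ} (hm : IsMultiplier m) {C : ℝ}
    (hC : ∀ τ ∈ Ioc (0 : ℝ) 1, |m τ| ≤ C) (x : H) :
    ‖cfc (fun τ => τ * m τ) T x‖ ≤ C * ‖T x‖ := by
  have hC0 : 0 ≤ C := (abs_nonneg _).trans (hC 1 (by simp))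
  have h1 := hT.norm_cfc_apply_le hm.continuousOn_mul (g := fun τ => C * τ) (by fun_prop)
    (fun τ hτ => by
      rcases hτ.1.eq_or_lt with rfl | h0
      · simp
      · rw [abs_mul, abs_mul, mul_comm]
        exact mul_le_mul_of_nonneg_right ((hC τ ⟨h0, hτ.2⟩).trans (le_abs_self C))
          (abs_nonneg τ)) x
  rw [hT.cfc_mul_apply (g := fun τ => τ) continuousOn_const continuousOn_id, hT.cfc_id_apply,
    cfc_const C T hT.isSelfAdjoint, Algebra.algebraMap_eq_smul_one] at h1
  simpa [norm_smul, abs_of_nonneg hC0] using h1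

lemma multOp_apply {m : ℝ → ℝ} (hm : IsMultiplier m) (x : H) :
    multOp T m (T x) = cfc (fun τ => τ * m τ) T x := by
  obtain ⟨C, hC⟩ := hm.2
  exact LinearMap.extendOfNorm_eq (e := (T : H →ₗ[ℂ] H)) hT.denseRange
    ⟨C, fun x => hT.norm_cfc_mul_le hm hC x⟩ x

lemma norm_multOp_le {m : ℝ → ℝ} (hm : IsMultiplier m) {C : ℝ}
    (hC : ∀ τ ∈ Ioc (0 : ℝ) 1, |m τ| ≤ C) (x : H) : ‖multOp T m x‖ ≤ C * ‖x‖ :=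
  LinearMap.norm_extendOfNorm_apply_le (e := (T : H →ₗ[ℂ] H)) hT.denseRange C
    (fun x => hT.norm_cfc_mul_le hm hC x) x

lemma multOp_congr {m n : ℝ → ℝ} (h : ∀ τ ∈ Ioc (0 : ℝ) 1, m τ = n τ) :
    multOp T m = multOp T n := by
  have h1 : cfc (fun τ => τ * m τ) T = cfc (fun τ => τ * n τ) T := by
    refine hT.cfc_congr_Icc fun τ hτ => ?_
    rcases hτ.1.eq_or_lt with rfl | h0
    · simp
    · rw [h τ ⟨h0, hτ.2⟩]
  rw [multOp, multOp, h1]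

lemma multOp_eq_cfc {f : ℝ → ℝ} (hf : ContinuousOn f (Icc 0 1)) : multOp T f = cfc f T := by
  refine hT.clm_ext fun x => ?_
  rw [hT.multOp_apply (.of_continuousOn hf), ← hT.cfc_id_apply x,
    ← hT.cfc_mul_apply hf (by fun_prop)]
  simp_rw [mul_comm]

lemma multOp_id_apply (x : H) : multOp T (fun τ => τ) x = T x := by
  rw [hT.multOp_eq_cfc (by fun_prop), hT.cfc_id_apply]

lemma multOp_one_sub_apply (x : H) : multOp T (fun τ => 1 - τ) x = x - T x := by
  rw [hT.multOp_eq_cfc (by fun_prop), hT.cfc_one_sub_apply]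

lemma multOp_add {m n : ℝ → ℝ} (hm : IsMultiplier m) (hn : IsMultiplier n) :
    multOp T (fun τ => m τ + n τ) = multOp T m + multOp T n := by
  refine hT.clm_ext fun x => ?_
  rw [add_apply, hT.multOp_apply (hm.add hn), hT.multOp_apply hm,
    hT.multOp_apply hn]
  simp_rw [mul_add]
  exact hT.cfc_add_apply hm.continuousOn_mul hn.continuousOn_mul x

lemma multOp_mul {m n : ℝ → ℝ} (hm : IsMultiplier m) (hn : IsMultiplier n) (x : H) :
    multOp T (fun τ => m τ * n τ) x = multOp T m (multOp T n x) := by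
  have comm : ∀ y, cfc (fun τ => τ * n τ) T (T y) = T (cfc (fun τ => τ * n τ) T y) := by
    intro y
    rw [← hT.cfc_id_apply y, ← hT.cfc_id_apply (cfc _ T y),
      ← hT.cfc_mul_apply hn.continuousOn_mul (by fun_prop),
      ← hT.cfc_mul_apply (by fun_prop) hn.continuousOn_mul]
    simp_rw [mul_comm]
  have h : multOp T (fun τ => m τ * n τ) ∘L T = multOp T m ∘L multOp T n ∘L T := by
    refine hT.clm_ext fun y => ?_
    simp only [ContinuousLinearMap.comp_apply]
    rw [hT.multOp_apply (hm.mul hn), hT.multOp_apply hn, comm, hT.multOp_apply hm,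
      ← hT.cfc_mul_apply hm.continuousOn_mul hn.continuousOn_mul, ← hT.cfc_id_apply y,
      ← hT.cfc_mul_apply (hm.mul hn).continuousOn_mul (by fun_prop)]
    congr 2
    ext τ
    ring
  have h' : multOp T (fun τ => m τ * n τ) = multOp T m ∘L multOp T n :=
    hT.clm_ext fun y => DFunLike.congr_fun h y
  rw [h']
  rfl

lemma inner_multOp {m : ℝ → ℝ} (hm : IsMultiplier m) (x y : H) :
    ⟪multOp T m x, y⟫_ℂ = ⟪x, multOp T m y⟫_ℂ := by
  have hself : ∀ a b : H, ⟪T a, b⟫_ℂ = ⟪a, T b⟫_ℂ := fun a b => hT.isSelfAdjoint.isSymmetric a b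
  have comm : ∀ a, T (multOp T m a) = cfc (fun τ => τ * m τ) T a := by
    intro a
    have h := hT.multOp_mul (.of_continuousOn (m := fun τ => τ) (by fun_prop)) hm a
    rw [hT.multOp_eq_cfc hm.continuousOn_mul, hT.multOp_eq_cfc (by fun_prop),
      hT.cfc_id_apply] at h
    exact h.symm
  refine hT.denseRange.induction_on (p := fun x => ⟪multOp T m x, y⟫_ℂ = ⟪x, multOp T m y⟫_ℂ) x
    (isClosed_eq (by fun_prop) (by fun_prop)) fun a => ?_
  rw [hT.multOp_apply hm, inner_cfc, hself, comm]

/-- Strong continuity of `t ↦ m_t(T)`: the family is uniformly bounded, and Lipschitz in `t` on the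
dense range of `T`. -/
lemma continuousOn_multOp {m : ℝ → ℝ → ℝ} {s : Set ℝ} {C : ℝ}
    (hm : ∀ t ∈ s, IsMultiplier (m t)) (hC : ∀ t ∈ s, ∀ τ ∈ Ioc (0 : ℝ) 1, |m t τ| ≤ C)
    (hL : ∀ t ∈ s, ∀ r ∈ s, ∀ τ ∈ Ioc (0 : ℝ) 1, τ * |m t τ - m r τ| ≤ C * |t - r|) (x : H) :
    ContinuousOn (fun t => multOp T (m t) x) s := by
  rcases s.eq_empty_or_nonempty with rfl | ⟨t₀, ht₀⟩
  · exact continuousOn_empty _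
  have hC0 : 0 ≤ C := (abs_nonneg _).trans (hC t₀ ht₀ 1 (by simp))
  have hlip : ∀ y, ∀ t ∈ s, ∀ r ∈ s,
      ‖multOp T (m t) (T y) - multOp T (m r) (T y)‖ ≤ C * |t - r| * ‖y‖ := by
    intro y t ht r hr
    rw [hT.multOp_apply (hm t ht), hT.multOp_apply (hm r hr), ← sub_apply,
      ← cfc_sub _ _ T ((hm t ht).continuousOn_mul.mono hT.spectrum_subset)
        ((hm r hr).continuousOn_mul.mono hT.spectrum_subset)]
    refine hT.norm_cfc_apply_le_const
      ((hm t ht).continuousOn_mul.sub (hm r hr).continuousOn_mul) (fun τ hτ => ?_) y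
    change |τ * m t τ - τ * m r τ| ≤ _
    rcases hτ.1.eq_or_lt with rfl | h0
    · simp only [zero_mul, sub_self, abs_zero]; positivity
    · rw [← mul_sub, abs_mul, abs_of_pos h0]
      exact hL t ht r hr τ ⟨h0, hτ.2⟩
  rw [Metric.continuousOn_iff]
  intro t ht ε hε
  obtain ⟨_, hy, y, rfl⟩ := Metric.dense_iff.mp hT.denseRange x (ε / (3 * (C + 1))) (by positivity)
  rw [Metric.mem_ball, dist_comm, dist_eq_norm] at hy
  refine ⟨ε / (3 * (C * ‖y‖ + 1)), by positivity, fun r hr hrt => ?_⟩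
  rw [Real.dist_eq] at hrt
  rw [dist_eq_norm]
  have h1 : ∀ r ∈ s, ‖multOp T (m r) (x - T y)‖ ≤ ε / 3 := by
    intro r hr
    refine (hT.norm_multOp_le (hm r hr) (hC r hr) _).trans ?_
    calc C * ‖x - T y‖ ≤ (C + 1) * (ε / (3 * (C + 1))) := by gcongr; linarith
      _ = ε / 3 := by field_simp
  have h2 : ‖multOp T (m r) (T y) - multOp T (m t) (T y)‖ < ε / 3 := by
    refine (hlip y r hr t ht).trans_lt ?_
    calc C * |r - t| * ‖y‖ ≤ (C * ‖y‖ + 1) * |r - t| := by nlinarith [abs_nonneg (r - t)]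
      _ < (C * ‖y‖ + 1) * (ε / (3 * (C * ‖y‖ + 1))) := by gcongr
      _ = ε / 3 := by field_simp
  have h3 : multOp T (m r) x - multOp T (m t) x = multOp T (m r) (x - T y)
      + (multOp T (m r) (T y) - multOp T (m t) (T y)) - multOp T (m t) (x - T y) := by
    simp only [map_sub]; abel
  rw [h3]
  have h4 := norm_sub_le (multOp T (m r) (x - T y)
      + (multOp T (m r) (T y) - multOp T (m t) (T y))) (multOp T (m t) (x - T y))
  have h5 := norm_add_le (multOp T (m r) (x - T y))
    (multOp T (m r) (T y) - multOp T (m t) (T y))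
  linarith [h1 r hr, h1 t ht]

/-- Differentiability of `t ↦ f_t(T)`, from a second-order Taylor estimate of `t ↦ f_t(τ)` that is
uniform in `τ`. -/
lemma hasDerivWithinAt_multOp {m m' : ℝ → ℝ → ℝ} {s : Set ℝ} {C : ℝ}
    (hm : ∀ t ∈ s, IsMultiplier (m t)) (hm' : ∀ t ∈ s, IsMultiplier (m' t))
    (hC : ∀ t ∈ s, ∀ r ∈ s, ∀ τ ∈ Ioc (0 : ℝ) 1,
      |m r τ - m t τ - (r - t) * m' t τ| ≤ C * (r - t) ^ 2) {t : ℝ} (ht : t ∈ s) (x : H) :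
    HasDerivWithinAt (fun t => multOp T (m t) x) (multOp T (m' t) x) s t := by
  rw [hasDerivWithinAt_iff_isLittleO]
  have hO : (fun r => multOp T (m r) x - multOp T (m t) x - (r - t) • multOp T (m' t) x)
      =O[𝓝[s] t] fun r => (r - t) ^ 2 := by
    refine Asymptotics.IsBigO.of_bound (C * ‖x‖) ?_
    filter_upwards [self_mem_nhdsWithin] with r hr
    have e : multOp T (m r) x - multOp T (m t) x - (r - t) • multOp T (m' t) x =
        multOp T (fun τ => m r τ + ((-1) * m t τ + (-(r - t)) * m' t τ)) x := by
      have hc : ∀ (c : ℝ) (n : ℝ → ℝ), IsMultiplier n →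
          multOp T (fun τ => c * n τ) x = c • multOp T n x := by
        intro c n hn
        rw [hT.multOp_mul (.of_continuousOn continuousOn_const) hn,
          hT.multOp_eq_cfc continuousOn_const, cfc_const c T hT.isSelfAdjoint,
          Algebra.algebraMap_eq_smul_one]
        simp
      rw [hT.multOp_add (hm r hr) (((hm t ht).const_mul _).add ((hm' t ht).const_mul _)),
        hT.multOp_add ((hm t ht).const_mul _) ((hm' t ht).const_mul _)]
      simp only [add_apply]
      rw [hc _ _ (hm t ht), hc _ _ (hm' t ht)]
      module
    rw [e]
    refine (hT.norm_multOp_le ((hm r hr).add (((hm t ht).const_mul _).add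
      ((hm' t ht).const_mul _))) (C := C * (r - t) ^ 2) (fun τ hτ => ?_) x).trans ?_
    · convert hC t ht r hr τ hτ using 2
      ring
    · rw [Real.norm_of_nonneg (sq_nonneg _)]
      exact le_of_eq (by ring)
  refine hO.trans_isLittleO ?_
  have h1 : (fun r : ℝ => (r - t) ^ 2) =o[𝓝 t] fun r => r - t := by
    have := Asymptotics.isLittleO_pow_sub_sub (E' := ℝ) t (m := 2) (by norm_num)
    simpa using this
  exact h1.mono nhdsWithin_le_nhds

end IsInjectiveContraction

end Calculus

/-! ### The damped oscillator -/

section DampedOscillator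

/-- The generator of the first-order system of `y'' + y' + l y = 0` in the variables `(y, y')`. -/
def oscGen (l : ℝ) : ℝ × ℝ →L[ℝ] ℝ × ℝ :=
  (ContinuousLinearMap.snd ℝ ℝ ℝ).prod
    (-(l • ContinuousLinearMap.fst ℝ ℝ ℝ) - ContinuousLinearMap.snd ℝ ℝ ℝ)

/-- The solution `(y, y')` of `y'' + y' + l y = 0` with data `(a, b)`, where `l = (1 - τ) / τ`; so
`τ = (1 + l)⁻¹` is the spectral variable of the resolvent. -/
def oscFlow (a b t τ : ℝ) : ℝ × ℝ := NormedSpace.exp (t • oscGen ((1 - τ) / τ)) (a, b)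

/-- The position `y` of the damped oscillator with data `(a, b)`. -/
def oscPos (a b t τ : ℝ) : ℝ := (oscFlow a b t τ).1

/-- The velocity `y'` of the damped oscillator with data `(a, b)`. -/
def oscVel (a b t τ : ℝ) : ℝ := (oscFlow a b t τ).2

variable (a b t τ : ℝ)

lemma hasDerivAt_oscFlow :
    HasDerivAt (fun t => oscFlow a b t τ) (oscGen ((1 - τ) / τ) (oscFlow a b t τ)) t := by
  have h := hasDerivAt_exp_smul_const' (oscGen ((1 - τ) / τ)) t
  exact h.clm_apply (hasDerivAt_const t (a, b)) |>.congr_deriv (by simp [oscFlow])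

lemma hasDerivAt_oscPos : HasDerivAt (fun t => oscPos a b t τ) (oscVel a b t τ) t := by
  have h := (ContinuousLinearMap.fst ℝ ℝ ℝ).hasFDerivAt.comp_hasDerivAt t
    (hasDerivAt_oscFlow a b t τ)
  exact h

lemma hasDerivAt_oscVel : HasDerivAt (fun t => oscVel a b t τ)
    (-((1 - τ) / τ * oscPos a b t τ) - oscVel a b t τ) t := by
  have h := (ContinuousLinearMap.snd ℝ ℝ ℝ).hasFDerivAt.comp_hasDerivAt t
    (hasDerivAt_oscFlow a b t τ)
  exact h

@[simp] lemma oscPos_zero : oscPos a b 0 τ = a := by simp [oscPos, oscFlow]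

@[simp] lemma oscVel_zero : oscVel a b 0 τ = b := by simp [oscVel, oscFlow]

lemma continuousOn_oscFlow : ContinuousOn (oscFlow a b t) (Ioc 0 1) := by
  have h1 : ContinuousOn (fun τ : ℝ => (1 - τ) / τ) (Ioc 0 1) :=
    ContinuousOn.div (by fun_prop) (by fun_prop) fun τ hτ => hτ.1.ne'
  have h2 : Continuous oscGen := by
    have : oscGen = fun l => oscGen 0 - l • (oscGen 0 - oscGen 1) := by
      ext l <;> simp [oscGen]
    rw [this]
    fun_prop
  let _ : NormedAlgebra ℚ (ℝ × ℝ →L[ℝ] ℝ × ℝ) := NormedAlgebra.restrictScalars ℚ ℝ _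
  have h3 : Continuous (NormedSpace.exp : (ℝ × ℝ →L[ℝ] ℝ × ℝ) → _) := NormedSpace.exp_continuous
  exact ((h3.comp (h2.const_smul t)).comp_continuousOn h1).clm_apply continuousOn_const

lemma continuousOn_oscPos : ContinuousOn (oscPos a b t) (Ioc 0 1) :=
  (continuousOn_oscFlow a b t).fst

lemma continuousOn_oscVel : ContinuousOn (oscVel a b t) (Ioc 0 1) :=
  (continuousOn_oscFlow a b t).snd

/-- The energy `E = y'² + y y' + (l + 1/2) y²` satisfies `E' = -y'² - l y²`. Since
`(1 - τ) (l + 1) = l`, this is at most `-(2/3) (1 - τ) E`, which gives exponential decay at a rate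
comparable to `min(l, 1)`. -/
lemma osc_energy_le {τ t : ℝ} (hτ : τ ∈ Ioc (0 : ℝ) 1) (ht : 0 ≤ t) :
    oscVel a b t τ ^ 2 + oscPos a b t τ * oscVel a b t τ +
        ((1 - τ) / τ + 1 / 2) * oscPos a b t τ ^ 2 ≤
      (b ^ 2 + a * b + ((1 - τ) / τ + 1 / 2) * a ^ 2) * Real.exp (-(2 / 3 * ((1 - τ) * t))) := by
  obtain ⟨h0, h1⟩ := hτ
  set l := (1 - τ) / τ with hl
  have hl0 : 0 ≤ l := div_nonneg (by linarith) h0.le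
  have hlτ : (1 - τ) * (l + 1) = l := by rw [hl]; field_simp; ring
  set F : ℝ → ℝ := fun t => oscVel a b t τ ^ 2 + oscPos a b t τ * oscVel a b t τ +
        (l + 1 / 2) * oscPos a b t τ ^ 2 with hF
  have hF' : ∀ t, HasDerivAt F (-(oscVel a b t τ) ^ 2 - l * oscPos a b t τ ^ 2) t := by
    intro t
    have hy := hasDerivAt_oscPos a b t τ
    have hv := hasDerivAt_oscVel a b t τ
    refine (((hv.pow 2).add (hy.mul hv)).add ((hy.pow 2).const_mul (l + 1 / 2))).congr_deriv ?_
    simp only [← hl]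
    push_cast
    ring
  have hG : ∀ t, HasDerivAt (fun t => F t * Real.exp (2 / 3 * ((1 - τ) * t)))
      (((-(oscVel a b t τ) ^ 2 - l * oscPos a b t τ ^ 2) + 2 / 3 * (1 - τ) * F t) *
        Real.exp (2 / 3 * ((1 - τ) * t))) t := by
    intro t
    have he : HasDerivAt (fun t => Real.exp (2 / 3 * ((1 - τ) * t)))
        (Real.exp (2 / 3 * ((1 - τ) * t)) * (2 / 3 * ((1 - τ) * 1))) t :=
      (((hasDerivAt_id t).const_mul (1 - τ)).const_mul (2 / 3)).exp
    exact ((hF' t).mul he).congr_deriv (by ring)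
  have hanti : Antitone fun t => F t * Real.exp (2 / 3 * ((1 - τ) * t)) := by
    refine antitone_of_deriv_nonpos (fun t => (hG t).differentiableAt) fun t => ?_
    rw [(hG t).deriv]
    refine mul_nonpos_of_nonpos_of_nonneg ?_ (Real.exp_pos _).le
    have hb : F t ≤ 3 / 2 * oscVel a b t τ ^ 2 + (l + 1) * oscPos a b t τ ^ 2 := by
      simp only [hF]
      nlinarith [sq_nonneg (oscVel a b t τ - oscPos a b t τ)]
    have hb' := mul_le_mul_of_nonneg_left hb (by linarith : 0 ≤ 1 - τ)
    have hb'' : (1 - τ) * (3 / 2 * oscVel a b t τ ^ 2 + (l + 1) * oscPos a b t τ ^ 2) ≤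
        3 / 2 * oscVel a b t τ ^ 2 + l * oscPos a b t τ ^ 2 := by
      have : (1 - τ) * (3 / 2 * oscVel a b t τ ^ 2 + (l + 1) * oscPos a b t τ ^ 2) =
        (1 - τ) * (3 / 2 * oscVel a b t τ ^ 2) + (1 - τ) * (l + 1) * oscPos a b t τ ^ 2 := by ring
      rw [this, hlτ]
      nlinarith [sq_nonneg (oscVel a b t τ)]
    nlinarith [mul_nonneg hl0 (sq_nonneg (oscPos a b t τ))]
  have h2 := hanti ht
  simp only [mul_zero, Real.exp_zero, mul_one] at h2
  have h3 : F 0 = b ^ 2 + a * b + (l + 1 / 2) * a ^ 2 := by simp [hF]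
  rw [h3, ← le_div_iff₀ (Real.exp_pos _)] at h2
  rw [Real.exp_neg, ← div_eq_mul_inv]
  exact h2

variable {a b t τ}

lemma oscPos_sq_le (hτ : τ ∈ Ioc (0 : ℝ) 1) (ht : 0 ≤ t) :
    oscPos a b t τ ^ 2 ≤ 4 * τ * ((b ^ 2 + a * b + ((1 - τ) / τ + 1 / 2) * a ^ 2) *
      Real.exp (-(2 / 3 * ((1 - τ) * t)))) := by
  have h := osc_energy_le a b hτ ht
  have h0 := hτ.1
  have h1 : (1 - τ) / τ = 1 / τ - 1 := by field_simp
  have h2 : 1 / 4 * (1 / τ) * oscPos a b t τ ^ 2 ≤ oscVel a b t τ ^ 2 +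
      oscPos a b t τ * oscVel a b t τ + ((1 - τ) / τ + 1 / 2) * oscPos a b t τ ^ 2 := by
    have h3 : 1 ≤ 1 / τ := by rw [le_div_iff₀ h0]; linarith [hτ.2]
    rw [h1]
    nlinarith [sq_nonneg (oscVel a b t τ + oscPos a b t τ / 2),
      mul_nonneg (sub_nonneg.mpr h3) (sq_nonneg (oscPos a b t τ))]
  have h4 := mul_le_mul_of_nonneg_left (h2.trans h) (by positivity : 0 ≤ 4 * τ)
  refine le_trans (le_of_eq ?_) h4
  field_simp

lemma oscVel_sq_le (hτ : τ ∈ Ioc (0 : ℝ) 1) (ht : 0 ≤ t) :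
    oscVel a b t τ ^ 2 ≤ 2 * (b ^ 2 + a * b + ((1 - τ) / τ + 1 / 2) * a ^ 2) := by
  have h := osc_energy_le a b hτ ht
  have h0 := hτ.1
  have hl : 0 ≤ (1 - τ) / τ := div_nonneg (by linarith [hτ.2]) h0.le
  have he : Real.exp (-(2 / 3 * ((1 - τ) * t))) ≤ 1 := by
    rw [Real.exp_le_one_iff]
    have : 0 ≤ (1 - τ) * t := mul_nonneg (by linarith [hτ.2]) ht
    linarith
  have h1 : 0 ≤ b ^ 2 + a * b + ((1 - τ) / τ + 1 / 2) * a ^ 2 := by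
    nlinarith [sq_nonneg (b + a / 2), mul_nonneg hl (sq_nonneg a)]
  have h2 := mul_le_mul_of_nonneg_left he h1
  nlinarith [sq_nonneg (oscVel a b t τ + oscPos a b t τ),
    mul_nonneg hl (sq_nonneg (oscPos a b t τ))]

lemma abs_oscPos_one_zero_le (hτ : τ ∈ Ioc (0 : ℝ) 1) (ht : 0 ≤ t) :
    |oscPos 1 0 t τ| ≤ 2 * Real.exp (-(1 / 3 * ((1 - τ) * t))) := by
  refine abs_le_of_sq_le_sq ((oscPos_sq_le hτ ht).trans ?_) (by positivity)
  have h0 := hτ.1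
  rw [mul_pow, ← Real.exp_nat_mul, ← mul_assoc]
  have : ((2 : ℕ) : ℝ) * -(1 / 3 * ((1 - τ) * t)) = -(2 / 3 * ((1 - τ) * t)) := by
    push_cast; ring
  rw [this]
  gcongr
  have : 4 * τ * (0 ^ 2 + 1 * 0 + ((1 - τ) / τ + 1 / 2) * 1 ^ 2) = 4 - 2 * τ := by
    field_simp; ring
  rw [this]
  linarith

lemma abs_oscPos_zero_one_le (hτ : τ ∈ Ioc (0 : ℝ) 1) (ht : 0 ≤ t) :
    |oscPos 0 1 t τ| ≤ 2 * τ ^ (1 / 2 : ℝ) * Real.exp (-(1 / 3 * ((1 - τ) * t))) := by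
  have h0 := hτ.1
  refine abs_le_of_sq_le_sq ((oscPos_sq_le hτ ht).trans (le_of_eq ?_)) (by positivity)
  rw [mul_pow, mul_pow, ← Real.exp_nat_mul, ← Real.sqrt_eq_rpow, Real.sq_sqrt h0.le]
  have : ((2 : ℕ) : ℝ) * -(1 / 3 * ((1 - τ) * t)) = -(2 / 3 * ((1 - τ) * t)) := by
    push_cast; ring
  rw [this]
  ring

lemma abs_oscVel_zero_one_le (hτ : τ ∈ Ioc (0 : ℝ) 1) (ht : 0 ≤ t) :
    |oscVel 0 1 t τ| ≤ 2 := by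
  refine abs_le_of_sq_le_sq ((oscVel_sq_le hτ ht).trans ?_) (by positivity)
  norm_num

/-- For the two unit data the initial energy is at most `1 + l = τ⁻¹`; hence these bounds, which are
uniform in `l`. -/
lemma abs_osc_le (hab : (a = 1 ∧ b = 0) ∨ (a = 0 ∧ b = 1)) (hτ : τ ∈ Ioc (0 : ℝ) 1) (ht : 0 ≤ t) :
    |oscPos a b t τ| ≤ 2 ∧ τ * |oscVel a b t τ| ≤ 2 := by
  have h0 := hτ.1
  have hl : 0 ≤ (1 - τ) / τ := div_nonneg (by linarith [hτ.2]) h0.le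
  have he : Real.exp (-(1 / 3 * ((1 - τ) * t))) ≤ 1 := by
    rw [Real.exp_le_one_iff]
    have : 0 ≤ (1 - τ) * t := mul_nonneg (by linarith [hτ.2]) ht
    linarith
  rcases hab with ⟨rfl, rfl⟩ | ⟨rfl, rfl⟩
  · refine ⟨(abs_oscPos_one_zero_le hτ ht).trans (by linarith), ?_⟩
    refine (pow_le_pow_iff_left₀ (by positivity) (by norm_num) two_ne_zero).mp ?_
    rw [mul_pow, sq_abs]
    have h1 := mul_le_mul_of_nonneg_left (oscVel_sq_le (a := 1) (b := 0) hτ ht) (sq_nonneg τ)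
    have h2 : τ ^ 2 * (2 * (0 ^ 2 + 1 * 0 + ((1 - τ) / τ + 1 / 2) * 1 ^ 2)) = τ * (2 - τ) := by
      field_simp; ring
    rw [h2] at h1
    nlinarith [hτ.2]
  · refine ⟨(abs_oscPos_zero_one_le hτ ht).trans ?_, ?_⟩
    · have : τ ^ (1 / 2 : ℝ) ≤ 1 := Real.rpow_le_one h0.le hτ.2 (by norm_num)
      calc 2 * τ ^ (1 / 2 : ℝ) * Real.exp (-(1 / 3 * ((1 - τ) * t))) ≤ 2 * 1 * 1 := by gcongr
        _ = 2 := by norm_num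
    · calc τ * |oscVel 0 1 t τ| ≤ 1 * 2 := by
            gcongr
            exacts [hτ.2, abs_oscVel_zero_one_le hτ ht]
        _ = 2 := by norm_num

/-- Second-order Taylor estimate on the half-line. -/
lemma abs_taylor_le {f f' f'' : ℝ → ℝ} (hf : ∀ t, HasDerivAt f (f' t) t)
    (hf' : ∀ t, HasDerivAt f' (f'' t) t) {M : ℝ} (hM : ∀ t, 0 ≤ t → |f'' t| ≤ M) {t r : ℝ}
    (ht : 0 ≤ t) (hr : 0 ≤ r) : |f r - f t - (r - t) * f' t| ≤ M * (r - t) ^ 2 := by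
  have hM0 : 0 ≤ M := (abs_nonneg _).trans (hM 0 le_rfl)
  have h1 : ∀ x, 0 ≤ x → |f' x - f' t| ≤ M * |x - t| := fun x hx =>
    (convex_Ici (0 : ℝ)).norm_image_sub_le_of_norm_hasDerivWithin_le
      (fun y _ => (hf' y).hasDerivWithinAt) (fun y hy => hM y hy) ht hx
  have h2 := (convex_uIcc t r).norm_image_sub_le_of_norm_hasDerivWithin_le
    (f := fun x => f x - x * f' t) (f' := fun x => f' x - 1 * f' t) (C := M * |r - t|)
    (fun x _ => ((hf x).sub ((hasDerivAt_id x).mul_const (f' t))).hasDerivWithinAt)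
    (fun x hx => by
      have hx0 : 0 ≤ x := (le_min ht hr).trans hx.1
      rw [one_mul]
      refine (h1 x hx0).trans ?_
      exact mul_le_mul_of_nonneg_left (abs_sub_left_of_mem_uIcc hx) hM0)
    left_mem_uIcc right_mem_uIcc
  rw [Real.norm_eq_abs, Real.norm_eq_abs] at h2
  calc |f r - f t - (r - t) * f' t| = |f r - r * f' t - (f t - t * f' t)| := by congr 1; ring
    _ ≤ M * |r - t| * |r - t| := h2
    _ = M * (r - t) ^ 2 := by rw [mul_assoc, abs_mul_abs_self, sq]

variable (hab : (a = 1 ∧ b = 0) ∨ (a = 0 ∧ b = 1)) (hτ : τ ∈ Ioc (0 : ℝ) 1)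

include hab hτ

lemma abs_oscPos_taylor_le {t r : ℝ} (ht : 0 ≤ t) (hr : 0 ≤ r) :
    τ * |oscPos a b r τ - oscPos a b t τ - (r - t) * oscVel a b t τ| ≤ 4 * (r - t) ^ 2 := by
  have h0 := hτ.1
  have := abs_taylor_le (hasDerivAt_oscPos a b · τ) (hasDerivAt_oscVel a b · τ) (M := 4 / τ)
    (fun t ht => by
      obtain ⟨h1, h2⟩ := abs_osc_le hab hτ ht
      rw [le_div_iff₀' h0]
      calc τ * |-((1 - τ) / τ * oscPos a b t τ) - oscVel a b t τ|
          ≤ τ * (|(1 - τ) / τ * oscPos a b t τ| + |oscVel a b t τ|) := by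
            gcongr
            exact (abs_sub _ _).trans_eq (by rw [abs_neg])
        _ = (1 - τ) * |oscPos a b t τ| + τ * |oscVel a b t τ| := by
            rw [abs_mul, abs_of_nonneg (div_nonneg (by linarith [hτ.2]) h0.le)]
            field_simp
        _ ≤ 1 * 2 + 2 := by gcongr; linarith
        _ = 4 := by norm_num) ht hr
  calc _ ≤ τ * (4 / τ * (r - t) ^ 2) := by gcongr
    _ = 4 * (r - t) ^ 2 := by field_simp

lemma abs_oscVel_taylor_le {t r : ℝ} (ht : 0 ≤ t) (hr : 0 ≤ r) :
    τ ^ 2 * |oscVel a b r τ - oscVel a b t τ - (r - t) *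
      (-((1 - τ) / τ * oscPos a b t τ) - oscVel a b t τ)| ≤ 6 * (r - t) ^ 2 := by
  have h0 := hτ.1
  have := abs_taylor_le (hasDerivAt_oscVel a b · τ)
    (fun t => ((hasDerivAt_oscPos a b t τ).const_mul ((1 - τ) / τ)).neg.sub
      (hasDerivAt_oscVel a b t τ)) (M := 6 / τ ^ 2)
    (fun t ht => by
      obtain ⟨h1, h2⟩ := abs_osc_le hab hτ ht
      rw [le_div_iff₀' (by positivity)]
      have e : τ ^ 2 * |-((1 - τ) / τ * oscVel a b t τ) -
          (-((1 - τ) / τ * oscPos a b t τ) - oscVel a b t τ)| =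
          |(2 * τ - 1) * (τ * oscVel a b t τ) + τ * (1 - τ) * oscPos a b t τ| := by
        nth_rw 1 [← abs_of_pos (by positivity : 0 < τ ^ 2)]
        rw [← abs_mul]
        congr 1
        field_simp
        ring
      rw [e]
      have h3 : |2 * τ - 1| ≤ 1 := abs_le.mpr ⟨by linarith, by linarith [hτ.2]⟩
      have h4 : |τ * (1 - τ)| ≤ 1 := by
        rw [abs_of_nonneg (mul_nonneg h0.le (by linarith [hτ.2]))]
        nlinarith [hτ.2]
      calc _ ≤ |2 * τ - 1| * (τ * |oscVel a b t τ|) + |τ * (1 - τ)| * |oscPos a b t τ| := by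
            refine (abs_add_le _ _).trans_eq ?_
            rw [abs_mul, abs_mul (τ * (1 - τ)), abs_mul τ (oscVel a b t τ), abs_of_pos h0]
        _ ≤ 1 * 2 + 1 * 2 := by gcongr
        _ ≤ 6 := by norm_num) ht hr
  calc _ ≤ τ ^ 2 * (6 / τ ^ 2 * (r - t) ^ 2) := by gcongr
    _ = 6 * (r - t) ^ 2 := by field_simp

end DampedOscillator

/-! ### The damped wave propagator and its decay -/

section Propagator

/-- The pairs of data `(a, b)` and exponents `θ` for which `τ ^ (-θ) y(t, τ)` is a multiplier, where
`y` solves `y'' + y' + l y = 0`, `y(0) = a`, `y'(0) = b`. The datum `b = 1` gains half a power of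
`A`, since `y` is then of size `(1 + l) ^ (-1/2)`. -/
def IsAdmissible (a b θ : ℝ) : Prop :=
  (a = 1 ∧ b = 0 ∧ θ = 0) ∨ (a = 0 ∧ b = 1 ∧ 0 ≤ θ ∧ θ ≤ 1 / 2)

/-- The multiplier `τ ^ (-θ) y(t, τ)` of the damped wave propagator. -/
def propMul (a b θ t τ : ℝ) : ℝ := oscPos a b t τ * τ ^ (-θ)

/-- The time derivative of `τ ^ 3 * propMul`. The weight makes it, and its own time derivative,
multipliers. -/
def propMulDeriv (a b θ t τ : ℝ) : ℝ := τ ^ 3 * (oscVel a b t τ * τ ^ (-θ))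

variable {a b θ : ℝ} (hab : IsAdmissible a b θ)

include hab

lemma IsAdmissible.data : (a = 1 ∧ b = 0) ∨ (a = 0 ∧ b = 1) := by
  rcases hab with ⟨h1, h2, -⟩ | ⟨h1, h2, -⟩
  exacts [Or.inl ⟨h1, h2⟩, Or.inr ⟨h1, h2⟩]

lemma IsAdmissible.le_half : 0 ≤ θ ∧ θ ≤ 1 / 2 := by
  rcases hab with ⟨-, -, rfl⟩ | ⟨-, -, h⟩
  exacts [by norm_num, h]

lemma IsAdmissible.mul_rpow_le {τ : ℝ} (hτ : τ ∈ Ioc (0 : ℝ) 1) : τ * τ ^ (-θ) ≤ 1 := by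
  nth_rw 1 [← Real.rpow_one τ]
  rw [← Real.rpow_add hτ.1]
  exact Real.rpow_le_one hτ.1.le hτ.2 (by linarith [hab.le_half.2])

lemma abs_oscPos_le_rpow {t τ : ℝ} (hτ : τ ∈ Ioc (0 : ℝ) 1) (ht : 0 ≤ t) :
    |oscPos a b t τ| ≤ 2 * τ ^ θ * Real.exp (-(1 / 3 * ((1 - τ) * t))) := by
  rcases hab with ⟨rfl, rfl, rfl⟩ | ⟨rfl, rfl, -, h⟩
  · simpa using abs_oscPos_one_zero_le hτ ht
  · refine (abs_oscPos_zero_one_le hτ ht).trans ?_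
    have := Real.rpow_le_rpow_of_exponent_ge hτ.1 hτ.2 h
    gcongr

lemma abs_propMul_le {t τ : ℝ} (hτ : τ ∈ Ioc (0 : ℝ) 1) (ht : 0 ≤ t) :
    |propMul a b θ t τ| ≤ 2 := by
  have h0 := hτ.1
  have he : Real.exp (-(1 / 3 * ((1 - τ) * t))) ≤ 1 := by
    rw [Real.exp_le_one_iff]
    have : 0 ≤ (1 - τ) * t := mul_nonneg (by linarith [hτ.2]) ht
    linarith
  rw [propMul, abs_mul, abs_of_pos (Real.rpow_pos_of_pos h0 (-θ)), Real.rpow_neg h0.le,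
    ← div_eq_mul_inv, div_le_iff₀ (by positivity)]
  refine (abs_oscPos_le_rpow hab hτ ht).trans ?_
  have : 0 ≤ 2 * τ ^ θ := by positivity
  nlinarith

lemma abs_oscVel_mul_rpow_le {t τ : ℝ} (hτ : τ ∈ Ioc (0 : ℝ) 1) (ht : 0 ≤ t) :
    τ * |oscVel a b t τ * τ ^ (-θ)| ≤ 2 := by
  have h0 := hτ.1
  have h1 := hab.mul_rpow_le hτ
  have h2 := abs_osc_le hab.data hτ ht
  rcases hab with ⟨rfl, rfl, rfl⟩ | ⟨rfl, rfl, -, -⟩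
  · simpa using h2.2
  · rw [abs_mul, abs_of_pos (Real.rpow_pos_of_pos h0 (-θ))]
    calc _ = |oscVel 0 1 t τ| * (τ * τ ^ (-θ)) := by ring
      _ ≤ 2 * 1 := by gcongr; exact abs_oscVel_zero_one_le hτ ht
      _ = 2 := by norm_num

omit hab in
lemma continuousOn_rpow_const_Ioc (p : ℝ) : ContinuousOn (fun τ : ℝ => τ ^ p) (Ioc 0 1) :=
  continuousOn_id.rpow_const fun _ hτ => Or.inl hτ.1.ne'

lemma isMultiplier_propMul {t : ℝ} (ht : 0 ≤ t) : IsMultiplier (propMul a b θ t) :=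
  ⟨(continuousOn_oscPos a b t).mul (continuousOn_rpow_const_Ioc _), 2,
    fun _ hτ => abs_propMul_le hab hτ ht⟩

lemma isMultiplier_propMulDeriv {t : ℝ} (ht : 0 ≤ t) : IsMultiplier (propMulDeriv a b θ t) := by
  refine ⟨ContinuousOn.mul (by fun_prop)
    ((continuousOn_oscVel a b t).mul (continuousOn_rpow_const_Ioc _)), 2, fun τ hτ => ?_⟩
  have h0 := hτ.1
  rw [propMulDeriv, abs_mul, abs_of_pos (by positivity : 0 < τ ^ 3)]
  calc _ = τ ^ 2 * (τ * |oscVel a b t τ * τ ^ (-θ)|) := by ring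
    _ ≤ 1 * 2 := by
      gcongr
      exacts [pow_le_one₀ h0.le hτ.2, abs_oscVel_mul_rpow_le hab hτ ht]
    _ = 2 := by norm_num

lemma propMul_lipschitz {t r τ : ℝ} (ht : 0 ≤ t) (hr : 0 ≤ r) (hτ : τ ∈ Ioc (0 : ℝ) 1) :
    τ * |propMul a b θ t τ - propMul a b θ r τ| ≤ 2 * |t - r| := by
  have h0 := hτ.1
  have h := (convex_Ici (0 : ℝ)).norm_image_sub_le_of_norm_hasDerivWithin_le
      (f := fun t => propMul a b θ t τ) (f' := fun t => oscVel a b t τ * τ ^ (-θ)) (C := 2 / τ)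
      (fun y _ => ((hasDerivAt_oscPos a b y τ).mul_const _).hasDerivWithinAt)
      (fun y hy => by
        rw [le_div_iff₀' h0]
        exact abs_oscVel_mul_rpow_le hab hτ hy) hr ht
  rw [Real.norm_eq_abs, Real.norm_eq_abs] at h
  calc _ ≤ τ * (2 / τ * |t - r|) := by gcongr
    _ = 2 * |t - r| := by field_simp

lemma propMul_taylor {t r τ : ℝ} (ht : 0 ≤ t) (hr : 0 ≤ r) (hτ : τ ∈ Ioc (0 : ℝ) 1) :
    |τ ^ 3 * propMul a b θ r τ - τ ^ 3 * propMul a b θ t τ - (r - t) * propMulDeriv a b θ t τ| ≤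
      6 * (r - t) ^ 2 := by
  have h0 := hτ.1
  have h1 := abs_oscPos_taylor_le hab.data hτ ht hr
  have h2 := hab.mul_rpow_le hτ
  have h3 := Real.rpow_pos_of_pos h0 (-θ)
  calc _ = |τ * (τ * τ ^ (-θ)) * τ *
        (oscPos a b r τ - oscPos a b t τ - (r - t) * oscVel a b t τ)| := by
        congr 1
        simp only [propMul, propMulDeriv]
        ring
    _ = τ * (τ * τ ^ (-θ)) *
        (τ * |oscPos a b r τ - oscPos a b t τ - (r - t) * oscVel a b t τ|) := by
        rw [abs_mul, abs_of_pos (by positivity)]; ring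
    _ ≤ 1 * 1 * (4 * (r - t) ^ 2) := by gcongr; exact hτ.2
    _ ≤ 6 * (r - t) ^ 2 := by nlinarith [sq_nonneg (r - t)]

lemma propMulDeriv_taylor {t r τ : ℝ} (ht : 0 ≤ t) (hr : 0 ≤ r) (hτ : τ ∈ Ioc (0 : ℝ) 1) :
    |propMulDeriv a b θ r τ - propMulDeriv a b θ t τ - (r - t) *
      ((-1) * (τ ^ 2 * (1 - τ) * propMul a b θ t τ) + (-1) * propMulDeriv a b θ t τ)| ≤
      6 * (r - t) ^ 2 := by
  have h0 := hτ.1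
  have h1 := abs_oscVel_taylor_le hab.data hτ ht hr
  have h2 := hab.mul_rpow_le hτ
  have h3 := Real.rpow_pos_of_pos h0 (-θ)
  calc _ = |τ * τ ^ (-θ) * τ ^ 2 * (oscVel a b r τ - oscVel a b t τ - (r - t) *
          (-((1 - τ) / τ * oscPos a b t τ) - oscVel a b t τ))| := by
        congr 1
        simp only [propMul, propMulDeriv]
        field_simp
        ring
    _ = τ * τ ^ (-θ) * (τ ^ 2 * |oscVel a b r τ - oscVel a b t τ - (r - t) *
          (-((1 - τ) / τ * oscPos a b t τ) - oscVel a b t τ)|) := by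
        rw [abs_mul, abs_of_pos (by positivity)]; ring
    _ ≤ 1 * (6 * (r - t) ^ 2) := by gcongr
    _ = 6 * (r - t) ^ 2 := one_mul _

variable {H : Type*} [NormedAddCommGroup H] [InnerProductSpace ℂ H] [CompleteSpace H]
  {T : H →L[ℂ] H} (hT : IsInjectiveContraction T)

include hT

lemma continuousOn_propagator (h : H) :
    ContinuousOn (fun t => multOp T (propMul a b θ t) h) (Ici 0) :=
  hT.continuousOn_multOp (fun _ ht => isMultiplier_propMul hab ht)
    (fun _ ht _ hτ => abs_propMul_le hab hτ ht)
    (fun _ ht _ hr _ hτ => propMul_lipschitz hab ht hr hτ) h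

lemma hasDerivWithinAt_propagator {t : ℝ} (ht : 0 ≤ t) (h : H) :
    HasDerivWithinAt (fun t => multOp T (fun τ => τ ^ 3) (multOp T (propMul a b θ t) h))
      (multOp T (propMulDeriv a b θ t) h) (Ici 0) t := by
  have h1 := hT.hasDerivWithinAt_multOp (m := fun t τ => τ ^ 3 * propMul a b θ t τ)
    (m' := propMulDeriv a b θ) (s := Ici 0) (C := 6)
    (fun t ht => (IsMultiplier.of_continuousOn (by fun_prop)).mul (isMultiplier_propMul hab ht))
    (fun t ht => isMultiplier_propMulDeriv hab ht)
    (fun t ht r hr τ hτ => propMul_taylor hab ht hr hτ) ht h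
  have h2 : ∀ r, 0 ≤ r → multOp T (fun τ => τ ^ 3) (multOp T (propMul a b θ r) h) =
      multOp T (fun τ => τ ^ 3 * propMul a b θ r τ) h := fun r hr =>
    (hT.multOp_mul (.of_continuousOn (by fun_prop)) (isMultiplier_propMul hab hr) h).symm
  exact h1.congr (fun r hr => h2 r hr) (h2 t ht)

lemma hasDerivWithinAt_propagatorDeriv {t : ℝ} (ht : 0 ≤ t) (h : H) :
    HasDerivWithinAt (fun t => multOp T (propMulDeriv a b θ t) h)
      (-multOp T (fun τ => τ ^ 2 * (1 - τ)) (multOp T (propMul a b θ t) h) -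
        multOp T (propMulDeriv a b θ t) h) (Ici 0) t := by
  have hm : ∀ t ∈ Ici (0 : ℝ), IsMultiplier fun τ => τ ^ 2 * (1 - τ) * propMul a b θ t τ :=
    fun t ht => (IsMultiplier.of_continuousOn (by fun_prop)).mul (isMultiplier_propMul hab ht)
  have h1 := hT.hasDerivWithinAt_multOp (m := propMulDeriv a b θ)
    (m' := fun t τ => (-1) * (τ ^ 2 * (1 - τ) * propMul a b θ t τ) +
      (-1) * propMulDeriv a b θ t τ) (s := Ici 0) (C := 6)
    (fun t ht => isMultiplier_propMulDeriv hab ht)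
    (fun t ht => ((hm t ht).const_mul _).add ((isMultiplier_propMulDeriv hab ht).const_mul _))
    (fun t ht r hr τ hτ => propMulDeriv_taylor hab ht hr hτ) ht h
  refine h1.congr_deriv ?_
  have hneg : ∀ n : ℝ → ℝ, IsMultiplier n → multOp T (fun τ => (-1) * n τ) h = -multOp T n h := by
    intro n hn
    rw [hT.multOp_mul (.of_continuousOn continuousOn_const) hn,
      hT.multOp_eq_cfc continuousOn_const, cfc_const (-1) T hT.isSelfAdjoint,
      Algebra.algebraMap_eq_smul_one]
    simp
  rw [hT.multOp_add ((hm t ht).const_mul _) ((isMultiplier_propMulDeriv hab ht).const_mul _),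
    add_apply, hneg _ (hm t ht), hneg _ (isMultiplier_propMulDeriv hab ht), ← sub_eq_add_neg,
    hT.multOp_mul (.of_continuousOn (by fun_prop)) (isMultiplier_propMul hab ht)]

omit hab in
lemma multOp_propMul_one_zero (h : H) : multOp T (propMul 1 0 0 0) h = h := by
  have h1 : multOp T (propMul 1 0 0 0) = cfc (fun _ : ℝ => (1 : ℝ)) T := by
    rw [← hT.multOp_eq_cfc continuousOn_const]
    exact hT.multOp_congr fun τ _ => by simp [propMul]
  rw [h1, cfc_const_one ℝ T hT.isSelfAdjoint]
  rfl

omit hab in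
lemma multOp_eq_zero {m : ℝ → ℝ} (hm : ∀ τ, m τ = 0) (h : H) : multOp T m h = 0 := by
  have h1 : multOp T m = cfc (fun _ : ℝ => (0 : ℝ)) T := by
    rw [← hT.multOp_eq_cfc continuousOn_const]
    exact hT.multOp_congr fun τ _ => hm τ
  rw [h1, cfc_const_zero ℝ T]
  rfl

omit hab in
lemma multOp_propMulDeriv_zero_one (h : H) :
    multOp T (propMulDeriv 0 1 θ 0) h = multOp T (fun τ => τ ^ (3 - θ)) h := by
  congr 1
  refine hT.multOp_congr fun τ hτ => ?_
  rw [propMulDeriv, oscVel_zero, one_mul, ← Real.rpow_natCast, ← Real.rpow_add hτ.1]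
  norm_num [sub_eq_add_neg]

end Propagator

section Decay

lemma exists_rpow_mul_exp_le {p : ℝ} (hp : 0 ≤ p) : ∃ C : ℝ, 0 < C ∧ ∀ x ∈ Icc (0 : ℝ) 1, ∀ t,
    0 ≤ t → x ^ p * Real.exp (-(1 / 3 * (x * t))) ≤ C * (1 + t) ^ (-p) := by
  -- `1 + y ≤ K exp (y / K)` for `K ≥ 1`, raised to the power `p`; the rate `p / K` is at most `1/3`
  -- for `K = 3 p + 1`
  have hK : 1 ≤ 3 * p + 1 := by linarith
  set K := 3 * p + 1 with hKdef
  refine ⟨K ^ p, by positivity, fun x hx t ht => ?_⟩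
  have h1 : (1 + t) * x ≤ K * Real.exp (x * t / K) := by
    have h2 := Real.add_one_le_exp (x * t / K)
    have h3 : K * (x * t / K + 1) = x * t + K := by field_simp
    have h4 := mul_le_mul_of_nonneg_left h2 (by linarith : 0 ≤ K)
    nlinarith [hx.1, hx.2]
  have h5 : ((1 + t) * x) ^ p ≤ K ^ p * Real.exp (1 / 3 * (x * t)) := by
    refine (Real.rpow_le_rpow (mul_nonneg (by linarith) hx.1) h1 hp).trans ?_
    rw [Real.mul_rpow (by linarith) (Real.exp_pos _).le, ← Real.exp_mul]
    refine mul_le_mul_of_nonneg_left (Real.exp_le_exp.mpr ?_) (by positivity)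
    have hxt : 0 ≤ x * t := mul_nonneg hx.1 ht
    rw [div_mul_eq_mul_div, div_le_iff₀ (by linarith)]
    nlinarith
  rw [Real.mul_rpow (by linarith) hx.1] at h5
  rw [Real.exp_neg, Real.rpow_neg (by linarith), ← div_eq_mul_inv, ← div_eq_mul_inv,
    div_le_div_iff₀ (Real.exp_pos _) (Real.rpow_pos_of_pos (by linarith) p)]
  linarith

/-- The weight `α = (τ ^ p + (1 - τ) ^ p)⁻¹`, which splits `1 = α τ ^ p + α (1 - τ) ^ p` into a part
seen by the low-frequency norm and a part that vanishes to order `p` at zero frequency. -/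
def splitWeight (p τ : ℝ) : ℝ := (τ ^ p + (1 - τ) ^ p)⁻¹

variable {p : ℝ} (hp : 0 ≤ p)

include hp

lemma le_splitWeight_denom {τ : ℝ} (hτ : τ ∈ Icc (0 : ℝ) 1) :
    (1 / 2 : ℝ) ^ p ≤ τ ^ p + (1 - τ) ^ p := by
  have h1 : 0 ≤ τ ^ p := Real.rpow_nonneg hτ.1 p
  have h2 : 0 ≤ (1 - τ) ^ p := Real.rpow_nonneg (by linarith [hτ.2]) p
  rcases le_total (1 / 2) τ with h | h
  · linarith [Real.rpow_le_rpow (by norm_num) h hp]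
  · linarith [Real.rpow_le_rpow (by norm_num) (by linarith : 1 / 2 ≤ 1 - τ) hp]

lemma abs_splitWeight_le {τ : ℝ} (hτ : τ ∈ Icc (0 : ℝ) 1) : |splitWeight p τ| ≤ 2 ^ p := by
  have h1 := le_splitWeight_denom hp hτ
  have h2 : (0 : ℝ) < (1 / 2) ^ p := by positivity
  rw [splitWeight, abs_of_pos (inv_pos.mpr (h2.trans_le h1))]
  calc _ ≤ ((1 / 2 : ℝ) ^ p)⁻¹ := inv_anti₀ h2 h1
    _ = 2 ^ p := by rw [one_div, Real.inv_rpow (by norm_num), inv_inv]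

omit hp in
lemma continuousOn_one_sub_rpow {q : ℝ} (hq : 0 ≤ q) :
    ContinuousOn (fun τ : ℝ => (1 - τ) ^ q) (Icc 0 1) :=
  ((Real.continuous_rpow_const hq).comp (continuous_const.sub continuous_id)).continuousOn

lemma continuousOn_splitWeight : ContinuousOn (splitWeight p) (Icc 0 1) := by
  refine ContinuousOn.inv₀ ((Real.continuous_rpow_const hp).continuousOn.add
    (continuousOn_one_sub_rpow hp)) fun τ hτ => ?_
  have h2 : (0 : ℝ) < (1 / 2) ^ p := by positivity
  exact (h2.trans_le (le_splitWeight_denom hp hτ)).ne'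

variable {H : Type*} [NormedAddCommGroup H] [InnerProductSpace ℂ H] [CompleteSpace H]
  {A : H →ₗ.[ℂ] H} (hT : IsInjectiveContraction (resolvent A))

include hT

/-- For a multiplier `e` of the size of `τ ^ θ`, and `k = A ^ (-g) (I + A) ^ b h` with
`b - g = θ - (σ + g)`, the splitting `1 = α τ ^ p + α (1 - τ) ^ p`, `p = σ + g`, gives
`S ^ σ (e τ ^ (-θ))(T) h = (α e τ ^ (-θ) S ^ p)(T) S ^ σ h + (α e S ^ p)(T) k`, where
`S = I - T`. Both terms contain `S ^ p`. -/
lemma bddTransformPow_multOp_eq {σ g b θ K : ℝ} (hσ : 0 ≤ σ) (hσg : p = σ + g) (hθ : 0 ≤ θ)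
    (hb : -g + b = θ - p) {e : ℝ → ℝ} (hec : ContinuousOn e (Ioc 0 1))
    (he : ∀ τ ∈ Ioc (0 : ℝ) 1, |e τ| ≤ K * τ ^ θ) {h k : H} (hk : IsPower A (-g) b h k) :
    bddTransformPow A σ (multOp (resolvent A) (fun τ => e τ * τ ^ (-θ)) h) =
      multOp (resolvent A) (fun τ => splitWeight p τ * (1 - τ) ^ p * (e τ * τ ^ (-θ)))
        (bddTransformPow A σ h) +
      multOp (resolvent A) (fun τ => splitWeight p τ * (1 - τ) ^ p * e τ) k := by
  set T := resolvent A with hTdef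
  have hK : 0 ≤ K := by
    have := he 1 (by simp)
    rw [Real.one_rpow, mul_one] at this
    exact (abs_nonneg _).trans this
  have hmul : ∀ q, q ≤ θ → IsMultiplier fun τ => e τ * τ ^ (-q) := by
    intro q hq
    refine ⟨hec.mul (continuousOn_rpow_const_Ioc _), K, fun τ hτ => ?_⟩
    rw [abs_mul, abs_of_pos (Real.rpow_pos_of_pos hτ.1 _)]
    calc _ ≤ K * τ ^ θ * τ ^ (-q) := by
          have := Real.rpow_pos_of_pos hτ.1 (-q)
          gcongr
          exact he τ hτ
      _ = K * τ ^ (θ - q) := by rw [mul_assoc, ← Real.rpow_add hτ.1, sub_eq_add_neg]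
      _ ≤ K * 1 := by
          gcongr
          exact Real.rpow_le_one hτ.1.le hτ.2 (by linarith)
      _ = K := mul_one K
  have hα : IsMultiplier (splitWeight p) := .of_continuousOn (continuousOn_splitWeight hp)
  have hS : ∀ q : ℝ, 0 ≤ q → IsMultiplier fun τ => (1 - τ) ^ q :=
    fun q hq => .of_continuousOn (continuousOn_one_sub_rpow hq)
  have hP : ∀ q : ℝ, 0 ≤ q → IsMultiplier fun τ => τ ^ q :=
    fun q hq => .of_continuousOn (Real.continuous_rpow_const hq).continuousOn
  have hSop : ∀ q : ℝ, 0 ≤ q → bddTransformPow A q = multOp T fun τ => (1 - τ) ^ q :=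
    fun q hq => (hT.multOp_eq_cfc (continuousOn_one_sub_rpow hq)).symm
  have hPop : ∀ q : ℝ, 0 ≤ q → resolventPow A q = multOp T fun τ => τ ^ q :=
    fun q hq => (hT.multOp_eq_cfc (Real.continuous_rpow_const hq).continuousOn).symm
  have he0 : IsMultiplier e := by simpa using hmul 0 hθ
  -- positive and negative parts of the exponents in `hk`
  have ha1 : max (-g) 0 ≤ σ := max_le (by linarith) hσ
  have hq1 : max (-g + b) 0 ≤ θ := max_le (by linarith) hθ
  have hg : max g 0 - max (-g) 0 = g := by
    rcases le_total 0 g with h | h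
    · rw [max_eq_left h, max_eq_right (by linarith)]; ring
    · rw [max_eq_right h, max_eq_left (by linarith)]; ring
  have hq : max (-(-g + b)) 0 - max (-g + b) 0 = p - θ := by
    rcases le_total 0 (-g + b) with h | h
    · rw [max_eq_left h, max_eq_right (by linarith)]; linarith
    · rw [max_eq_right h, max_eq_left (by linarith)]; linarith
  rw [IsPower, neg_neg, hSop _ (le_max_right _ _), hSop _ (le_max_right _ _),
    hPop _ (le_max_right _ _), hPop _ (le_max_right _ _),
    ← hT.multOp_mul (hS _ (le_max_right _ _)) (hP _ (le_max_right _ _)),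
    ← hT.multOp_mul (hS _ (le_max_right _ _)) (hP _ (le_max_right _ _))] at hk
  set a₁ := max (-g) 0
  set a₂ := max g 0
  set q₁ := max (-(-g + b)) 0
  set q₂ := max (-g + b) 0
  have ha₁ : 0 ≤ a₁ := le_max_right _ _
  have ha₂ : 0 ≤ a₂ := le_max_right _ _
  have hq₁ : 0 ≤ q₁ := le_max_right _ _
  have hq₂ : 0 ≤ q₂ := le_max_right _ _
  have hN : IsMultiplier fun τ => splitWeight p τ * (e τ * τ ^ (-q₂)) * (1 - τ) ^ (σ - a₁) :=
    (hα.mul (hmul _ hq1)).mul (hS _ (by linarith))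
  have hk' := congrArg (multOp T fun τ => splitWeight p τ * (e τ * τ ^ (-q₂)) *
    (1 - τ) ^ (σ - a₁)) hk
  rw [← hT.multOp_mul hN ((hS _ ha₂).mul (hP _ hq₂)),
    ← hT.multOp_mul hN ((hS _ ha₁).mul (hP _ hq₁))] at hk'
  have hleft : multOp T (fun τ => splitWeight p τ * (1 - τ) ^ p * e τ) k =
      multOp T (fun τ => splitWeight p τ * (e τ * τ ^ (-θ)) * τ ^ p * (1 - τ) ^ σ) h := by
    refine Eq.trans ?_ (hk'.trans ?_)
    · congr 1
      refine hT.multOp_congr fun τ hτ => ?_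
      have h1 : τ ^ (-q₂) * τ ^ q₂ = 1 := by
        rw [← Real.rpow_add hτ.1, neg_add_cancel, Real.rpow_zero]
      have h2 : (1 - τ) ^ (σ - a₁) * (1 - τ) ^ a₂ = (1 - τ) ^ p := by
        rw [← Real.rpow_add_of_nonneg (by linarith [hτ.2]) (by linarith) ha₂]
        congr 1
        linarith
      rw [← h2]
      linear_combination (-(splitWeight p τ * e τ * (1 - τ) ^ (σ - a₁) * (1 - τ) ^ a₂)) * h1
    · congr 1
      refine hT.multOp_congr fun τ hτ => ?_
      have h1 : τ ^ (-q₂) * τ ^ q₁ = τ ^ (-θ) * τ ^ p := by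
        rw [← Real.rpow_add hτ.1, ← Real.rpow_add hτ.1]
        congr 1
        linarith
      have h2 : (1 - τ) ^ (σ - a₁) * (1 - τ) ^ a₁ = (1 - τ) ^ σ := by
        rw [← Real.rpow_add_of_nonneg (by linarith [hτ.2]) (by linarith) ha₁, sub_add_cancel]
      rw [← h2]
      linear_combination (splitWeight p τ * e τ * (1 - τ) ^ (σ - a₁) * (1 - τ) ^ a₁) * h1
  rw [hleft, hSop σ hσ, ← hT.multOp_mul (hS σ hσ) (hmul θ le_rfl),
    ← hT.multOp_mul ((hα.mul (hS p hp)).mul (hmul θ le_rfl)) (hS σ hσ), ← add_apply,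
    ← hT.multOp_add (((hα.mul (hS p hp)).mul (hmul θ le_rfl)).mul (hS σ hσ))
      (((hα.mul (hmul θ le_rfl)).mul (hP p hp)).mul (hS σ hσ))]
  congr 1
  refine hT.multOp_congr fun τ hτ => ?_
  have h1 : splitWeight p τ * (τ ^ p + (1 - τ) ^ p) = 1 := by
    have h2 : (0 : ℝ) < (1 / 2) ^ p := by positivity
    exact inv_mul_cancel₀ (h2.trans_le
      (le_splitWeight_denom hp (Ioc_subset_Icc_self hτ))).ne'
  linear_combination (-((1 - τ) ^ σ * (e τ * τ ^ (-θ)))) * h1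

omit hp in
lemma norm_bddTransformPow_le {σ : ℝ} (hσ : 0 ≤ σ) (h : H) : ‖bddTransformPow A σ h‖ ≤ ‖h‖ := by
  refine (hT.norm_cfc_apply_le_const (C := 1) (continuousOn_one_sub_rpow hσ) (fun τ hτ => ?_)
    h).trans_eq (one_mul _)
  rw [abs_of_nonneg (Real.rpow_nonneg (by linarith [hτ.2]) _)]
  exact Real.rpow_le_one (by linarith [hτ.2]) (by linarith [hτ.1]) hσ

/-- Decay of the propagator: a constant that depends on `p = σ + g` only. -/
lemma norm_bddTransformPow_propagator_le {C : ℝ} (hC0 : 0 ≤ C)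
    (hC : ∀ x ∈ Icc (0 : ℝ) 1, ∀ t, 0 ≤ t →
      x ^ p * Real.exp (-(1 / 3 * (x * t))) ≤ C * (1 + t) ^ (-p))
    {a b₀ θ : ℝ} (hab : IsAdmissible a b₀ θ) {σ g b : ℝ} (hσ : 0 ≤ σ) (hσg : p = σ + g)
    (hb : -g + b = θ - p) {h k : H} (hk : IsPower A (-g) b h k) {t : ℝ} (ht : 0 ≤ t) :
    ‖bddTransformPow A σ (multOp (resolvent A) (propMul a b₀ θ t) h)‖ ≤
      2 ^ p * (2 * C) * (1 + t) ^ (-p) * (‖h‖ + ‖k‖) := by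
  have hθ := hab.le_half.1
  have he : ∀ τ ∈ Ioc (0 : ℝ) 1, |oscPos a b₀ t τ| ≤ 2 * τ ^ θ := by
    intro τ hτ
    refine (abs_oscPos_le_rpow hab hτ ht).trans ?_
    have h1 : Real.exp (-(1 / 3 * ((1 - τ) * t))) ≤ 1 := by
      rw [Real.exp_le_one_iff]
      have : 0 ≤ (1 - τ) * t := mul_nonneg (by linarith [hτ.2]) ht
      linarith
    have : 0 ≤ 2 * τ ^ θ := mul_nonneg (by norm_num) (Real.rpow_nonneg hτ.1.le _)
    nlinarith
  have hα : IsMultiplier (splitWeight p) := .of_continuousOn (continuousOn_splitWeight hp)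
  have hS : IsMultiplier fun τ => (1 - τ) ^ p := .of_continuousOn (continuousOn_one_sub_rpow hp)
  have hbound : ∀ {n : ℝ → ℝ}, IsMultiplier n →
      (∀ τ ∈ Ioc (0 : ℝ) 1, |n τ| ≤ 2 * Real.exp (-(1 / 3 * ((1 - τ) * t)))) → ∀ x : H,
      ‖multOp (resolvent A) (fun τ => splitWeight p τ * (1 - τ) ^ p * n τ) x‖ ≤
        2 ^ p * (2 * C) * (1 + t) ^ (-p) * ‖x‖ := by
    intro n hn hle x
    refine hT.norm_multOp_le ((hα.mul hS).mul hn) (fun τ hτ => ?_) x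
    have h1 : 0 ≤ (1 - τ) ^ p := Real.rpow_nonneg (by linarith [hτ.2]) _
    rw [abs_mul, abs_mul, abs_of_nonneg h1]
    calc _ ≤ 2 ^ p * (1 - τ) ^ p * (2 * Real.exp (-(1 / 3 * ((1 - τ) * t)))) := by
          gcongr
          exacts [abs_splitWeight_le hp (Ioc_subset_Icc_self hτ), hle τ hτ]
      _ = 2 ^ p * 2 * ((1 - τ) ^ p * Real.exp (-(1 / 3 * ((1 - τ) * t)))) := by ring
      _ ≤ 2 ^ p * 2 * (C * (1 + t) ^ (-p)) := by
          exact mul_le_mul_of_nonneg_left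
            (hC (1 - τ) ⟨by linarith [hτ.2], by linarith [hτ.1]⟩ t ht) (by positivity)
      _ = _ := by ring
  have hE : IsMultiplier (oscPos a b₀ t) :=
    ⟨continuousOn_oscPos a b₀ t, 2, fun τ hτ => (abs_osc_le hab.data hτ ht).1⟩
  change ‖bddTransformPow A σ (multOp (resolvent A) (fun τ => oscPos a b₀ t τ * τ ^ (-θ)) h)‖ ≤ _
  rw [bddTransformPow_multOp_eq hp hT hσ hσg hθ hb (continuousOn_oscPos a b₀ t) he hk]
  refine (norm_add_le _ _).trans ?_
  rw [mul_add]
  refine add_le_add ((hbound (isMultiplier_propMul hab ht) (fun τ hτ => ?_) _).trans ?_)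
    (hbound hE (fun τ hτ => ?_) _)
  · have h0 := hτ.1
    rw [propMul, abs_mul, abs_of_pos (Real.rpow_pos_of_pos h0 (-θ)), Real.rpow_neg h0.le,
      ← div_eq_mul_inv, div_le_iff₀ (by positivity)]
    exact (abs_oscPos_le_rpow hab hτ ht).trans_eq (by ring)
  · have h1 := norm_bddTransformPow_le hT hσ h
    have h2 : 0 ≤ (1 + t) ^ (-p) := Real.rpow_nonneg (by linarith) _
    gcongr
  · refine (abs_oscPos_le_rpow hab hτ ht).trans ?_
    have : τ ^ θ ≤ 1 := Real.rpow_le_one hτ.1.le hτ.2 hθ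
    gcongr
    linarith

end Decay

/-! ### Uniqueness of weak solutions -/

section WeakUniqueness

variable {H : Type*} [NormedAddCommGroup H] [InnerProductSpace ℂ H] [CompleteSpace H]

/-- Scalar step of the uniqueness argument: `x'' + x' + y = 0` with zero data, where `x'` is merely
continuous at `0` and `X`, `Z` are primitives of `x`, `y`, with `Y` a primitive of `Z`, can be
integrated twice. -/
lemma integrate_twice {x w y X Z Y : ℝ → ℂ} (hw : ContinuousOn w (Ici 0))
    (hx : ∀ t, 0 ≤ t → HasDerivWithinAt x (w t) (Ici 0) t) (hw0 : w 0 = 0) (hx0 : x 0 = 0)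
    (hw' : ∀ t, 0 < t → HasDerivAt w (-(y t) - w t) t)
    (hX : ∀ t, 0 ≤ t → HasDerivWithinAt X (x t) (Ici 0) t) (hX0 : X 0 = 0)
    (hZ : ∀ t, 0 ≤ t → HasDerivWithinAt Z (y t) (Ici 0) t) (hZ0 : Z 0 = 0)
    (hY : ∀ t, 0 ≤ t → HasDerivWithinAt Y (Z t) (Ici 0) t) (hY0 : Y 0 = 0) {t : ℝ}
    (ht : 0 ≤ t) : x t + X t + Y t = 0 := by
  have hG' : ∀ t, 0 < t → HasDerivAt (fun t => w t + x t + Z t) 0 t := fun t ht =>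
    (((hw' t ht).add ((hx t ht.le).hasDerivAt (Ici_mem_nhds ht))).add
      ((hZ t ht.le).hasDerivAt (Ici_mem_nhds ht))).congr_deriv (by ring)
  have hGc : ContinuousOn (fun t => w t + x t + Z t) (Ici 0) :=
    (hw.add fun t ht => (hx t ht).continuousWithinAt).add
      fun t ht => (hZ t ht).continuousWithinAt
  -- the second equation is not assumed at `t = 0`, but the derivative extends by continuity
  have hG0 : HasDerivWithinAt (fun t => w t + x t + Z t) 0 (Ici 0) 0 := by
    refine hasDerivWithinAt_Ici_of_tendsto_deriv (s := Ioi 0)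
      (fun t ht => (hG' t ht).differentiableAt.differentiableWithinAt)
      ((hGc 0 self_mem_Ici).mono Ioi_subset_Ici_self) self_mem_nhdsWithin ?_
    refine tendsto_const_nhds.congr' ?_
    filter_upwards [self_mem_nhdsWithin] with t ht
    exact (hG' t ht).deriv.symm
  have hG : ∀ t, 0 ≤ t → w t + x t + Z t = 0 := by
    intro t ht
    have := constant_of_has_deriv_right_zero (hGc.mono Icc_subset_Ici_self) (fun r hr => by
      rcases hr.1.eq_or_lt with rfl | h0
      · exact hG0
      · exact (hG' r h0).hasDerivWithinAt) t (right_mem_Icc.mpr ht)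
    rw [this, hw0, hx0, hZ0]
    simp
  have hK' : ∀ t, 0 ≤ t → HasDerivWithinAt (fun t => x t + X t + Y t) 0 (Ici 0) t := fun t ht =>
    (((hx t ht).add (hX t ht)).add (hY t ht)).congr_deriv (hG t ht)
  have := constant_of_has_deriv_right_zero
    (fun r hr => (hK' r hr.1).continuousWithinAt.mono Icc_subset_Ici_self)
    (fun r hr => (hK' r hr.1).mono (Ici_subset_Ici.mpr hr.1)) t (right_mem_Icc.mpr ht)
  rw [this, hx0, hX0, hY0]
  simp

variable {T : H →L[ℂ] H} (hT : IsInjectiveContraction T)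

include hT

lemma re_inner_apply_self (x : H) :
    (⟪T x, x⟫_ℂ).re = ‖cfc (fun τ : ℝ => τ ^ (1 / 2 : ℝ)) T x‖ ^ 2 := by
  have hc : ContinuousOn (fun τ : ℝ => τ ^ (1 / 2 : ℝ)) (Icc 0 1) :=
    (Real.continuous_rpow_const (by norm_num)).continuousOn
  have h1 : T x = cfc (fun τ : ℝ => τ ^ (1 / 2 : ℝ)) T
      (cfc (fun τ : ℝ => τ ^ (1 / 2 : ℝ)) T x) := by
    rw [← hT.cfc_mul_apply hc hc, ← hT.cfc_id_apply x]
    congr 1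
    refine hT.cfc_congr_Icc fun τ hτ => ?_
    rw [← Real.rpow_add_of_nonneg hτ.1 (by norm_num) (by norm_num)]
    norm_num
  rw [h1, IsInjectiveContraction.inner_cfc]
  exact inner_self_eq_norm_sq (𝕜 := ℂ) _

lemma re_inner_sub_apply_nonneg (x : H) : 0 ≤ (⟪x - T x, x⟫_ℂ).re := by
  have hc : ContinuousOn (fun τ : ℝ => (1 - τ) ^ (1 / 2 : ℝ)) (Icc 0 1) :=
    continuousOn_one_sub_rpow (by norm_num)
  have h1 : x - T x = cfc (fun τ : ℝ => (1 - τ) ^ (1 / 2 : ℝ)) T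
      (cfc (fun τ : ℝ => (1 - τ) ^ (1 / 2 : ℝ)) T x) := by
    rw [← hT.cfc_mul_apply hc hc, ← hT.cfc_one_sub_apply x]
    congr 1
    refine hT.cfc_congr_Icc fun τ hτ => ?_
    rw [← Real.rpow_add_of_nonneg (by linarith [hτ.2]) (by norm_num) (by norm_num)]
    norm_num
  rw [h1, IsInjectiveContraction.inner_cfc]
  exact inner_self_nonneg (𝕜 := ℂ)

/-- Energy uniqueness for `T Y'' + T Y' + S Y = 0`, `S = I - T`: the energy
`⟪T Y', Y'⟫ + ⟪S Y, Y⟫` does not increase. -/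
lemma energy_uniqueness {U Z Y : ℝ → H} (hZ : ∀ t, HasDerivAt Z (U t) t)
    (hY : ∀ t, HasDerivAt Y (Z t) t) (hZ0 : Z 0 = 0) (hY0 : Y 0 = 0)
    (heq : ∀ t, 0 ≤ t → T (U t + Z t) + (Y t - T (Y t)) = 0) {t : ℝ} (ht : 0 ≤ t) : U t = 0 := by
  have hdT : ∀ {f : ℝ → H} {f' : H} {t : ℝ}, HasDerivAt f f' t →
      HasDerivAt (fun t => T (f t)) (T f') t := fun h =>
    (T.restrictScalars ℝ).hasFDerivAt.comp_hasDerivAt _ h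
  have hsymm : ∀ a b : H, (⟪T a, b⟫_ℂ).re = (⟪T b, a⟫_ℂ).re := fun a b => by
    have h1 : ⟪T a, b⟫_ℂ = ⟪a, T b⟫_ℂ := hT.isSelfAdjoint.isSymmetric a b
    rw [h1]
    exact inner_re_symm (𝕜 := ℂ) _ _
  set E : ℝ → ℝ := fun t => (⟪T (Z t), Z t⟫_ℂ).re + (⟪Y t - T (Y t), Y t⟫_ℂ).re with hE
  have hE' : ∀ t, HasDerivAt E (2 * (⟪T (U t) + (Y t - T (Y t)), Z t⟫_ℂ).re) t := by
    intro t
    have hre : ∀ {f : ℝ → ℂ} {f' : ℂ}, HasDerivAt f f' t →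
      HasDerivAt (fun t => (f t).re) f'.re t := fun h =>
      Complex.reCLM.hasFDerivAt.comp_hasDerivAt t h
    have h1 := hre ((hdT (hZ t)).inner ℂ (hZ t))
    have h2 := hre (((hY t).sub (hdT (hY t))).inner ℂ (hY t))
    refine (h1.add h2).congr_deriv ?_
    have h3 := hsymm (Z t) (U t)
    have h4 := hsymm (Z t) (Y t)
    have h5 : (⟪Z t, Y t⟫_ℂ).re = (⟪Y t, Z t⟫_ℂ).re := inner_re_symm (𝕜 := ℂ) _ _
    simp only [Pi.sub_apply, inner_add_left, inner_sub_left, Complex.add_re, Complex.sub_re]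
    linarith
  have hanti : AntitoneOn E (Ici 0) := by
    refine antitoneOn_of_deriv_nonpos (convex_Ici 0)
      (fun t _ => (hE' t).continuousAt.continuousWithinAt)
      (fun t _ => (hE' t).differentiableAt.differentiableWithinAt) fun t ht => ?_
    rw [interior_Ici] at ht
    have h1 : T (U t) + (Y t - T (Y t)) = -T (Z t) := by
      have := heq t (le_of_lt ht)
      rw [map_add] at this
      rw [eq_neg_iff_add_eq_zero, ← this]
      abel
    rw [(hE' t).deriv, h1, inner_neg_left, Complex.neg_re, re_inner_apply_self hT]
    nlinarith [sq_nonneg ‖cfc (fun τ : ℝ => τ ^ (1 / 2 : ℝ)) T (Z t)‖]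
  have hZt : ∀ t, 0 ≤ t → Z t = 0 := by
    intro t ht
    have h1 := hanti self_mem_Ici ht ht
    have h2 : E 0 = 0 := by simp [hE, hZ0, hY0]
    rw [h2] at h1
    simp only [hE] at h1
    rw [re_inner_apply_self hT] at h1
    have h3 := re_inner_sub_apply_nonneg hT (Y t)
    have h4 : ‖cfc (fun τ : ℝ => τ ^ (1 / 2 : ℝ)) T (Z t)‖ = 0 := by
      have := sq_nonneg ‖cfc (fun τ : ℝ => τ ^ (1 / 2 : ℝ)) T (Z t)‖
      exact pow_eq_zero_iff two_ne_zero |>.mp (by linarith)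
    exact hT.eq_zero_of_cfc_rpow_eq_zero (by norm_num) (norm_eq_zero.mp h4)
  have h1 : HasDerivWithinAt Z 0 (Ici 0) t :=
    (hasDerivWithinAt_const t (Ici 0) (0 : H)).congr (fun r hr => hZt r hr) (hZt t ht)
  exact (uniqueDiffOn_Ici (0 : ℝ) t ht).eq_deriv _ (hZ t).hasDerivWithinAt h1

/-- Uniqueness for the weak equation tested on a set `Γ` of pairs `(φ, R φ)` whose closure contains
the graph of the self-adjoint operator, that is, all pairs `(T f, f - T f)`. -/
lemma weak_uniqueness {Γ : Set (H × H)} (hΓ : ∀ f, (T f, f - T f) ∈ closure Γ) {U : ℝ → H}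
    (hU : ContinuousOn U (Ici 0)) (hU0 : ∀ z ∈ Γ, ⟪z.1, U 0⟫_ℂ = 0)
    (hw : ∀ z ∈ Γ, ∃ w : ℝ → ℂ, ContinuousOn w (Ici 0) ∧
      (∀ t, 0 ≤ t → HasDerivWithinAt (fun t => ⟪z.1, U t⟫_ℂ) (w t) (Ici 0) t) ∧ w 0 = 0 ∧
      ∀ t, 0 < t → HasDerivAt w (-⟪z.2, U t⟫_ℂ - w t) t) {t : ℝ} (ht : 0 ≤ t) : U t = 0 := by
  set V : ℝ → H := fun t => U (max t 0) with hV
  have hVU : ∀ t, 0 ≤ t → V t = U t := fun t ht => by simp [hV, max_eq_left ht]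
  have hVc : Continuous V :=
    hU.comp_continuous (continuous_id.max continuous_const) fun t => le_max_right t 0
  set Z : ℝ → H := fun t => ∫ r in (0 : ℝ)..t, V r with hZdef
  have hZ : ∀ t, HasDerivAt Z (V t) t := fun t => hVc.integral_hasStrictDerivAt 0 t |>.hasDerivAt
  have hZc : Continuous Z := continuous_iff_continuousAt.mpr fun t => (hZ t).continuousAt
  set Y : ℝ → H := fun t => ∫ r in (0 : ℝ)..t, Z r with hYdef
  have hY : ∀ t, HasDerivAt Y (Z t) t := fun t => hZc.integral_hasStrictDerivAt 0 t |>.hasDerivAt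
  have hZ0 : Z 0 = 0 := intervalIntegral.integral_same
  have hY0 : Y 0 = 0 := intervalIntegral.integral_same
  have hd : ∀ (a : H) {f : ℝ → H} {f' : H} {t : ℝ}, HasDerivAt f f' t →
      HasDerivWithinAt (fun t => ⟪a, f t⟫_ℂ) ⟪a, f'⟫_ℂ (Ici 0) t := fun a _ _ _ h =>
    (((innerSL ℂ a).restrictScalars ℝ).hasFDerivAt.comp_hasDerivAt _ h).hasDerivWithinAt
  have hΓ0 : ∀ t, 0 ≤ t → ∀ z ∈ Γ, ⟪z.1, V t + Z t⟫_ℂ + ⟪z.2, Y t⟫_ℂ = 0 := by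
    intro t ht z hz
    obtain ⟨w, hwc, hw1, hw2, hw3⟩ := hw z hz
    have h1 := integrate_twice (x := fun t => ⟪z.1, U t⟫_ℂ) (y := fun t => ⟪z.2, U t⟫_ℂ)
      (X := fun t => ⟪z.1, Z t⟫_ℂ) (Z := fun t => ⟪z.2, Z t⟫_ℂ) (Y := fun t => ⟪z.2, Y t⟫_ℂ)
      hwc hw1 hw2 (hU0 z hz) hw3
      (fun t ht => by simpa only [hVU t ht] using hd z.1 (hZ t)) (by simp [hZ0])
      (fun t ht => by simpa only [hVU t ht] using hd z.2 (hZ t)) (by simp [hZ0])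
      (fun t _ => hd z.2 (hY t)) (by simp [hY0]) ht
    rw [inner_add_right, hVU t ht]
    exact h1
  have heq : ∀ t, 0 ≤ t → T (V t + Z t) + (Y t - T (Y t)) = 0 := by
    intro t ht
    have h1 : ∀ z ∈ closure Γ, ⟪z.1, V t + Z t⟫_ℂ + ⟪z.2, Y t⟫_ℂ = 0 := by
      have hcl : IsClosed {z : H × H | ⟪z.1, V t + Z t⟫_ℂ + ⟪z.2, Y t⟫_ℂ = 0} :=
        isClosed_eq (by fun_prop) continuous_const
      exact fun z hz => closure_minimal (fun z hz => hΓ0 t ht z hz) hcl hz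
    refine ext_inner_left ℂ fun f => ?_
    have h2 := h1 _ (hΓ f)
    have hself : ∀ a b : H, ⟪T a, b⟫_ℂ = ⟪a, T b⟫_ℂ :=
      fun a b => hT.isSelfAdjoint.isSymmetric a b
    simp only [inner_sub_left, hself] at h2
    rw [inner_add_right, inner_sub_right, inner_zero_right]
    exact h2
  rw [← hVU t ht]
  exact energy_uniqueness hT hZ hY hZ0 hY0 heq ht

end WeakUniqueness

/-! ### Powers of the resolvent, distributions and Sobolev spaces -/

section ResolventPowers

variable {H : Type*} [NormedAddCommGroup H] [InnerProductSpace ℂ H] [CompleteSpace H]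
  {A : H →ₗ.[ℂ] H} (hT : IsInjectiveContraction (resolvent A))

include hT

lemma resolventPow_zero (x : H) : resolventPow A 0 x = x := by
  simp [resolventPow, cfc_const_one ℝ _ hT.isSelfAdjoint]

lemma bddTransformPow_zero (x : H) : bddTransformPow A 0 x = x := by
  simp [bddTransformPow, cfc_const_one ℝ _ hT.isSelfAdjoint]

lemma resolventPow_one (x : H) : resolventPow A 1 x = resolvent A x := by
  simp [resolventPow, hT.cfc_id_apply]

lemma resolventPow_resolventPow {p q : ℝ} (hp : 0 ≤ p) (hq : 0 ≤ q) (x : H) :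
    resolventPow A p (resolventPow A q x) = resolventPow A (p + q) x := by
  rw [resolventPow, resolventPow, ← hT.cfc_mul_apply
    (Real.continuous_rpow_const hp).continuousOn (Real.continuous_rpow_const hq).continuousOn]
  exact congrArg (· x) (hT.cfc_congr_Icc fun τ hτ => (Real.rpow_add_of_nonneg hτ.1 hp hq).symm)

lemma resolventPow_eq_multOp {p : ℝ} (hp : 0 ≤ p) :
    resolventPow A p = multOp (resolvent A) fun τ => τ ^ p :=
  (hT.multOp_eq_cfc (Real.continuous_rpow_const hp).continuousOn).symm

lemma resolventPow_multOp {p : ℝ} (hp : 0 ≤ p) {m : ℝ → ℝ} (hm : IsMultiplier m) (x : H) :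
    resolventPow A p (multOp (resolvent A) m x) = multOp (resolvent A) m (resolventPow A p x) := by
  have hp' : IsMultiplier fun τ => τ ^ p :=
    .of_continuousOn (Real.continuous_rpow_const hp).continuousOn
  rw [resolventPow_eq_multOp hT hp, ← hT.multOp_mul hp' hm, ← hT.multOp_mul hm hp']
  simp_rw [mul_comm]

lemma resolventPow_injective {p : ℝ} (hp : 0 ≤ p) {x y : H}
    (h : resolventPow A p x = resolventPow A p y) : x = y := by
  rw [← sub_eq_zero, ← map_sub] at h
  exact sub_eq_zero.mp (hT.eq_zero_of_cfc_rpow_eq_zero hp h)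

omit hT in
lemma inner_resolventPow (p : ℝ) (x y : H) :
    ⟪resolventPow A p x, y⟫_ℂ = ⟪x, resolventPow A p y⟫_ℂ :=
  IsInjectiveContraction.inner_cfc _ x y

/-- `(I + A) ^ (-q) f = T ^ (1 + q) (I + A) f` for `q ≥ -1` and `f` in the range of `T`. -/
lemma isPower_zero_neg_iff {q : ℝ} (hq : -1 ≤ q) {f g k : H} (hk : resolvent A k = f) :
    IsPower A 0 (-q) f g ↔ g = resolventPow A (1 + q) k := by
  have h1 : resolventPow A (max (-q) 0) (resolventPow A (1 + q) k) =
      resolventPow A (max q 0) f := by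
    rw [← hk, ← resolventPow_one hT k, resolventPow_resolventPow hT (le_max_right _ _)
      (by linarith), resolventPow_resolventPow hT (le_max_right _ _) zero_le_one]
    congr 2
    rcases le_total 0 q with h | h
    · rw [max_eq_left h, max_eq_right (by linarith)]; ring
    · rw [max_eq_right h, max_eq_left (by linarith)]; ring
  rw [IsPower]
  simp only [neg_zero, max_self, zero_add, neg_neg, bddTransformPow_zero hT]
  constructor
  · intro h
    exact resolventPow_injective hT (le_max_right (-q) 0) (h.trans h1.symm)
  · rintro rfl
    exact h1

lemma isPower_bddTransformPow {σ : ℝ} (hσ : 0 ≤ σ) (x : H) :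
    IsPower A σ (-σ) x (bddTransformPow A σ x) := by
  rw [IsPower]
  simp [max_eq_left hσ, max_eq_right (neg_nonpos.mpr hσ), bddTransformPow_zero hT,
    resolventPow_zero hT]

end ResolventPowers

section Glue

variable {E : Type*} [NormedAddCommGroup E] [NormedSpace ℝ E]
  {G : Type*} [TopologicalSpace G] [ChartedSpace E G] [Group G] [LieGroup 𝓘(ℝ, E) ∞ G]

lemma diffOp_one (f : SmoothFun E G ℂ) :
    diffOp (1 : FreeAlgebra ℂ (GroupLieAlgebra 𝓘(ℝ, E) G)) f = f := by
  rw [diffOp, map_one]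
  rfl

variable [IsTopologicalGroup G]

lemma Dist.ext {f g : Dist E G} (h : ∀ φ, f φ = g φ) : f = g :=
  Subtype.ext (LinearMap.ext h)

variable [MeasurableSpace G] [BorelSpace G] {μ : Measure G} [μ.IsHaarMeasure]
  {P : FreeAlgebra ℂ (GroupLieAlgebra 𝓘(ℝ, E) G)}

lemma mem_graph_minimalOp_iff {z : Lp ℂ 2 μ × Lp ℂ 2 μ} : z ∈ (minimalOp μ P).graph ↔
    ∃ φ : TestFun E G, z = (testToL2 μ φ, testToL2 μ (diffOpTest P φ)) := by
  have happ : ∀ φ : TestFun E G, (minimalOp μ P) ⟨testToL2 μ φ, φ, rfl⟩ =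
      testToL2 μ (diffOpTest P φ) := by
    intro φ
    change testToL2 μ (diffOpTest P ((LinearEquiv.ofInjective (testToL2 (E := E) μ)
      (testToL2_injective μ)).symm ⟨testToL2 μ φ, φ, rfl⟩)) = _
    congr 2
    rw [LinearEquiv.symm_apply_eq]
    rfl
  rw [LinearPMap.mem_graph_iff]
  constructor
  · rintro ⟨⟨_, φ, rfl⟩, h1, h2⟩
    refine ⟨φ, Prod.ext h1.symm (h2.symm.trans (happ φ))⟩
  · rintro ⟨φ, rfl⟩
    exact ⟨⟨testToL2 μ φ, φ, rfl⟩, rfl, happ φ⟩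

lemma re_inner_testToL2_nonneg (hpos : IsPositiveOp μ P) (φ : TestFun E G) :
    0 ≤ (⟪testToL2 μ φ, testToL2 μ (diffOpTest P φ)⟫_ℂ).re := by
  obtain ⟨c, hc, h⟩ := hpos φ
  have h1 : ⟪testToL2 μ φ, testToL2 μ (diffOpTest P φ)⟫_ℂ = (c : ℂ) := by
    rw [L2.inner_def, ← h]
    refine integral_congr_ae ?_
    filter_upwards [(memLp_testFun μ φ).coeFn_toLp,
      (memLp_testFun μ (diffOpTest P φ)).coeFn_toLp] with x h1 h2
    have h1' : (testToL2 μ φ : G → ℂ) x = (φ : G → ℂ) x := h1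
    have h2' : (testToL2 μ (diffOpTest P φ) : G → ℂ) x = (diffOpTest P φ : G → ℂ) x := h2
    rw [h1', h2', RCLike.inner_apply]
  rw [h1, Complex.ofReal_re]
  exact hc

variable (hess : IsSelfAdjoint (closedOp μ P))

include hess

lemma closedOp_graph_eq :
    ((closedOp μ P).graph : Set (Lp ℂ 2 μ × Lp ℂ 2 μ)) = closure (minimalOp μ P).graph := by
  have h1 : (minimalOp μ P).IsClosable := by
    rw [LinearPMap.isClosable_iff_exists_closed_extension]
    exact ⟨_, hess.isClosed, LinearPMap.le_closure _⟩
  rw [closedOp, ← h1.graph_closure_eq_closure_graph]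
  rfl

lemma mem_graph_closedOp (φ : TestFun E G) :
    (testToL2 μ φ, testToL2 μ (diffOpTest P φ)) ∈ (closedOp μ P).graph := by
  have h : (testToL2 μ φ, testToL2 μ (diffOpTest P φ)) ∈
      ((closedOp μ P).graph : Set (Lp ℂ 2 μ × Lp ℂ 2 μ)) := by
    rw [closedOp_graph_eq hess]
    exact subset_closure (mem_graph_minimalOp_iff.mpr ⟨φ, rfl⟩)
  exact h

variable (hpos : IsPositiveOp μ P)

include hpos

lemma closedOp_nonneg (x y : Lp ℂ 2 μ) (h : (x, y) ∈ (closedOp μ P).graph) :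
    0 ≤ (⟪x, y⟫_ℂ).re := by
  have h' : (x, y) ∈ ((closedOp μ P).graph : Set (Lp ℂ 2 μ × Lp ℂ 2 μ)) := h
  rw [closedOp_graph_eq hess] at h'
  have hcl : IsClosed {z : Lp ℂ 2 μ × Lp ℂ 2 μ | 0 ≤ (⟪z.1, z.2⟫_ℂ).re} :=
    isClosed_le continuous_const (by fun_prop)
  refine closure_minimal (fun z hz => ?_) hcl h'
  obtain ⟨φ, rfl⟩ := mem_graph_minimalOp_iff.mp hz
  exact re_inner_testToL2_nonneg hpos φ

lemma isInjectiveContraction_closedOp :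
    IsInjectiveContraction (resolvent (closedOp μ P)) :=
  isInjectiveContraction_resolvent hess (closedOp_nonneg hess hpos)

lemma resolvent_testToL2 (φ : TestFun E G) :
    resolvent (closedOp μ P) (testToL2 μ (φ + diffOpTest P φ)) = testToL2 μ φ := by
  rw [map_add]
  exact resolvent_add_of_mem_graph hess (closedOp_nonneg hess hpos) (mem_graph_closedOp hess φ)

/-- `(I + R) C_c^∞(G)` is dense, since `C_c^∞(G)` is a core of the self-adjoint closure. -/
lemma eq_zero_of_orthogonal_testFun {k : Lp ℂ 2 μ}
    (hk : ∀ φ : TestFun E G, ⟪testToL2 μ (φ + diffOpTest P φ), k⟫_ℂ = 0) : k = 0 := by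
  refine eq_zero_of_orthogonal_add hess (closedOp_nonneg hess hpos) fun x y h => ?_
  have h' : (x, y) ∈ ((closedOp μ P).graph : Set (Lp ℂ 2 μ × Lp ℂ 2 μ)) := h
  rw [closedOp_graph_eq hess] at h'
  have hcl : IsClosed {z : Lp ℂ 2 μ × Lp ℂ 2 μ | ⟪z.1 + z.2, k⟫_ℂ = 0} :=
    isClosed_eq (by fun_prop) continuous_const
  refine closure_minimal (fun z hz => ?_) hcl h'
  obtain ⟨φ, rfl⟩ := mem_graph_minimalOp_iff.mp hz
  have := hk φ
  rw [map_add] at this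
  exact this

/-- Since `φ = T (φ + R φ)`, the operator `(I + R) ^ (-σ / ν)` with `σ ≥ -ν` acts on a test function
`φ` as `T ^ (1 + σ / ν)` on `φ + R φ`. -/
lemma sobolevRep_iff {ν σ : ℝ} (hσ : -1 ≤ σ / ν) {f : Dist E G} {h : Lp ℂ 2 μ} :
    SobolevRep μ P ν σ f h ↔ ∀ φ : TestFun E G, f φ =
      ⟪resolventPow (closedOp μ P) (1 + σ / ν) (testToL2 μ (φ + diffOpTest P φ)), h⟫_ℂ := by
  refine forall_congr' fun φ => ?_
  have hiff := fun ψ => isPower_zero_neg_iff (isInjectiveContraction_closedOp hess hpos) hσ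
    (g := ψ) (resolvent_testToL2 hess hpos φ)
  rw [neg_div]
  simp only [hiff, exists_eq_left]

lemma sobolevRep_unique {ν σ : ℝ} (hσ : -1 ≤ σ / ν) {f : Dist E G} {h h' : Lp ℂ 2 μ}
    (hh : SobolevRep μ P ν σ f h) (hh' : SobolevRep μ P ν σ f h') : h = h' := by
  rw [sobolevRep_iff hess hpos hσ] at hh hh'
  refine resolventPow_injective (isInjectiveContraction_closedOp hess hpos)
    (by linarith : 0 ≤ 1 + σ / ν) (sub_eq_zero.mp (eq_zero_of_orthogonal_testFun hess hpos
      fun φ => ?_))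
  rw [inner_sub_right, ← inner_resolventPow, ← inner_resolventPow, ← hh, ← hh', sub_self]

lemma sobolevRep_iff_of_nonneg {ν σ : ℝ} (hσ : 0 ≤ σ / ν) {f : Dist E G} {h : Lp ℂ 2 μ} :
    SobolevRep μ P ν σ f h ↔ ∀ φ : TestFun E G, f φ =
      ⟪resolventPow (closedOp μ P) (σ / ν) (testToL2 μ φ), h⟫_ℂ := by
  rw [sobolevRep_iff hess hpos (by linarith)]
  have hT := isInjectiveContraction_closedOp hess hpos
  refine forall_congr' fun φ => ?_
  rw [add_comm 1, ← resolventPow_resolventPow hT hσ zero_le_one, resolventPow_one hT,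
    resolvent_testToL2 hess hpos]

omit hess hpos

lemma tendsto_testToL2 {K : Set G} {φ : ℕ → TestFun E G} (hK : IsCompact K)
    (hsupp : ∀ n, tsupport (φ n : G → ℂ) ⊆ K)
    (hφ : TendstoUniformly (fun n => (φ n : G → ℂ)) 0 atTop) :
    Tendsto (fun n => testToL2 μ (φ n)) atTop (𝓝 0) := by
  have hμ : μ K ≠ ⊤ := hK.measure_lt_top.ne
  rw [Metric.tendsto_atTop]
  intro ε hε
  set M : ℝ := (μ K ^ (2 : ℝ≥0∞).toReal⁻¹).toReal with hM
  have hMtop : μ K ^ (2 : ℝ≥0∞).toReal⁻¹ ≠ ⊤ := ENNReal.rpow_ne_top_of_nonneg (by positivity) hμ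
  have hM0 : 0 ≤ M := ENNReal.toReal_nonneg
  rw [Metric.tendstoUniformly_iff] at hφ
  obtain ⟨N, hN⟩ := eventually_atTop.mp (hφ (ε / (M + 1)) (by positivity))
  refine ⟨N, fun n hn => ?_⟩
  rw [dist_zero_right]
  have h1 : ‖testToL2 μ (φ n)‖ = (eLpNorm (φ n : G → ℂ) 2 μ).toReal :=
    Lp.norm_toLp _ (memLp_testFun μ (φ n))
  have h2 : eLpNorm (φ n : G → ℂ) 2 μ ≤
      μ K ^ (2 : ℝ≥0∞).toReal⁻¹ * ENNReal.ofReal (ε / (M + 1)) := by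
    rw [← eLpNorm_restrict_eq_of_support_subset ((subset_tsupport _).trans (hsupp n))]
    refine (eLpNorm_le_of_ae_bound (C := ε / (M + 1))
      (Eventually.of_forall fun x => ?_)).trans_eq ?_
    · have := hN n hn x
      rw [Pi.zero_apply, dist_zero_left] at this
      exact this.le
    · rw [Measure.restrict_apply_univ]
  rw [h1]
  calc _ ≤ (μ K ^ (2 : ℝ≥0∞).toReal⁻¹ * ENNReal.ofReal (ε / (M + 1))).toReal :=
        ENNReal.toReal_mono (ENNReal.mul_ne_top hMtop ENNReal.ofReal_ne_top) h2
    _ = M * (ε / (M + 1)) := by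
        rw [ENNReal.toReal_mul, ENNReal.toReal_ofReal (by positivity)]
    _ < ε := by
        rw [mul_div_assoc', div_lt_iff₀ (by positivity)]
        nlinarith

/-- The distribution `φ ↦ ⟪B φ, v⟫` of an `L²` vector `v` and a bounded operator `B`. -/
def distOfLp (B : Lp ℂ 2 μ →L[ℂ] Lp ℂ 2 μ) (v : Lp ℂ 2 μ) : Dist E G :=
  ⟨((innerₛₗ ℂ).flip v).comp ((B : Lp ℂ 2 μ →ₗ[ℂ] Lp ℂ 2 μ) ∘ₗ testToL2 μ), by
    intro K φ hK hsupp hφ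
    have h1 := tendsto_testToL2 (μ := μ) hK hsupp (by
      have := hφ 1
      have h2 : ∀ n, (diffOpTest (1 : FreeAlgebra ℂ (GroupLieAlgebra 𝓘(ℝ, E) G)) (φ n)) = φ n :=
        fun n => Subtype.ext (diffOp_one _)
      simpa only [h2] using this)
    have h2 : Continuous fun x : Lp ℂ 2 μ => ⟪B x, v⟫_ℂ := by fun_prop
    have h3 := (h2.tendsto 0).comp h1
    rwa [map_zero, inner_zero_left] at h3⟩

@[simp] lemma distOfLp_apply (B : Lp ℂ 2 μ →L[ℂ] Lp ℂ 2 μ) (v : Lp ℂ 2 μ)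
    (φ : TestFun E G) : distOfLp (E := E) B v φ = ⟪B (testToL2 μ φ), v⟫_ℂ := rfl

include hess hpos

lemma isSolution_unique {ν s : ℝ} (hs : 0 ≤ s / ν) {u₀ u₁ : Dist E G} {u v : ℝ → Dist E G}
    (hu : IsSolution μ P ν s u₀ u₁ u) (hv : IsSolution μ P ν s u₀ u₁ v) {t : ℝ} (ht : 0 ≤ t) :
    u t = v t := by
  have hT := isInjectiveContraction_closedOp hess hpos
  obtain ⟨a, hac, ha⟩ := hu.continuous
  obtain ⟨b, hbc, hb⟩ := hv.continuous
  set U : ℝ → Lp ℂ 2 μ := fun t => resolventPow (closedOp μ P) (s / ν) (a t - b t) with hU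
  have hin : ∀ t, 0 ≤ t → ∀ φ : TestFun E G, ⟪testToL2 μ φ, U t⟫_ℂ = u t φ - v t φ := by
    intro t ht φ
    rw [(sobolevRep_iff_of_nonneg hess hpos hs).mp (ha t ht) φ,
      (sobolevRep_iff_of_nonneg hess hpos hs).mp (hb t ht) φ, hU, ← inner_resolventPow,
      inner_sub_right]
  have hUc : ContinuousOn U (Ici 0) :=
    (resolventPow (closedOp μ P) (s / ν)).continuous.comp_continuousOn (hac.sub hbc)
  have hU0 : U t = 0 := by
    refine weak_uniqueness hT (Γ := (minimalOp μ P).graph) (fun f => ?_) hUc (fun z hz => ?_)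
      (fun z hz => ?_) ht
    · rw [← closedOp_graph_eq hess]
      exact resolvent_mem_graph hess (closedOp_nonneg hess hpos) f
    · obtain ⟨φ, rfl⟩ := mem_graph_minimalOp_iff.mp hz
      rw [hin 0 le_rfl, hu.init, hv.init, sub_self]
    · obtain ⟨φ, rfl⟩ := mem_graph_minimalOp_iff.mp hz
      obtain ⟨w, hw1, hw2, hw3, hw4⟩ := hu.equation φ
      obtain ⟨w', hw1', hw2', hw3', hw4'⟩ := hv.equation φ
      refine ⟨fun t => w t - w' t, hw1.sub hw1', fun t ht => ?_, ?_, fun t ht => ?_⟩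
      · exact ((hw2 t ht).sub (hw2' t ht)).congr (fun r hr => hin r hr φ) (hin t ht φ)
      · simp only [hw3, hw3', sub_self]
      · refine ((hw4 t ht).sub (hw4' t ht)).congr_deriv ?_
        rw [hin t ht.le]
        ring
  refine Dist.ext fun φ => ?_
  rw [← sub_eq_zero, ← hin t ht, hU0, inner_zero_right]

end Glue

/-! ### The solution of the Cauchy problem -/

section Existence

variable {H : Type*} [NormedAddCommGroup H] [InnerProductSpace ℂ H] [CompleteSpace H]

/-- The solution with data `v(0) = h₀`, `v_t(0) = T ^ (-θ) h₁`, in the abstract Hilbert space. -/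
def propagator (T : H →L[ℂ] H) (θ : ℝ) (h₀ h₁ : H) (t : ℝ) : H :=
  multOp T (propMul 1 0 0 t) h₀ + multOp T (propMul 0 1 θ t) h₁

/-- The velocity of `propagator`, with the weight `T ^ 3` that makes it a bounded function of the
data. -/
def propagatorDeriv (T : H →L[ℂ] H) (θ : ℝ) (h₀ h₁ : H) (t : ℝ) : H :=
  multOp T (propMulDeriv 1 0 0 t) h₀ + multOp T (propMulDeriv 0 1 θ t) h₁

lemma isAdmissible_one_zero : IsAdmissible 1 0 0 := Or.inl ⟨rfl, rfl, rfl⟩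

lemma isAdmissible_zero_one {θ : ℝ} (h0 : 0 ≤ θ) (h1 : θ ≤ 1 / 2) : IsAdmissible 0 1 θ :=
  Or.inr ⟨rfl, rfl, h0, h1⟩

variable {T : H →L[ℂ] H} (hT : IsInjectiveContraction T) {θ : ℝ} (hθ0 : 0 ≤ θ) (hθ : θ ≤ 1 / 2)
  (h₀ h₁ : H)

include hT

lemma propagator_zero : propagator T θ h₀ h₁ 0 = h₀ := by
  rw [propagator, multOp_propMul_one_zero hT,
    multOp_eq_zero hT (fun τ => by simp [propMul]), add_zero]

lemma propagatorDeriv_zero :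
    propagatorDeriv T θ h₀ h₁ 0 = multOp T (fun τ => τ ^ (3 - θ)) h₁ := by
  rw [propagatorDeriv, multOp_eq_zero hT (fun τ => by simp [propMulDeriv]), zero_add,
    multOp_propMulDeriv_zero_one hT]

include hθ0 hθ

lemma continuousOn_propagator_add : ContinuousOn (propagator T θ h₀ h₁) (Ici 0) :=
  (continuousOn_propagator isAdmissible_one_zero hT h₀).add
    (continuousOn_propagator (isAdmissible_zero_one hθ0 hθ) hT h₁)

lemma hasDerivWithinAt_cfc_propagator {t : ℝ} (ht : 0 ≤ t) :
    HasDerivWithinAt (fun t => multOp T (fun τ => τ ^ 3) (propagator T θ h₀ h₁ t))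
      (propagatorDeriv T θ h₀ h₁ t) (Ici 0) t := by
  simp only [propagator, map_add]
  exact (hasDerivWithinAt_propagator isAdmissible_one_zero hT ht h₀).add
    (hasDerivWithinAt_propagator (isAdmissible_zero_one hθ0 hθ) hT ht h₁)

lemma hasDerivWithinAt_cfc_propagatorDeriv {t : ℝ} (ht : 0 ≤ t) :
    HasDerivWithinAt (propagatorDeriv T θ h₀ h₁)
      (-multOp T (fun τ => τ ^ 2 * (1 - τ)) (propagator T θ h₀ h₁ t) -
        propagatorDeriv T θ h₀ h₁ t) (Ici 0) t := by
  refine ((hasDerivWithinAt_propagatorDeriv isAdmissible_one_zero hT ht h₀).add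
    (hasDerivWithinAt_propagatorDeriv (isAdmissible_zero_one hθ0 hθ) hT ht h₁)).congr_deriv ?_
  simp only [propagator, propagatorDeriv, map_add]
  abel

end Existence

section Solution

variable {E : Type*} [NormedAddCommGroup E] [NormedSpace ℝ E]
  {G : Type*} [TopologicalSpace G] [ChartedSpace E G] [Group G] [LieGroup 𝓘(ℝ, E) ∞ G]
  [IsTopologicalGroup G] [MeasurableSpace G] [BorelSpace G]
  {μ : Measure G} [μ.IsHaarMeasure] {P : FreeAlgebra ℂ (GroupLieAlgebra 𝓘(ℝ, E) G)}
  (hess : IsSelfAdjoint (closedOp μ P)) (hpos : IsPositiveOp μ P)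

include hess hpos

/-- Every test function lies in the range of every power of `T`: here
`φ = T ^ 3 k`, `φ + R φ = T ^ 2 k` and `R φ = T ^ 2 (I - T) k`, with `k = (I + R) ^ 3 φ`. -/
lemma exists_testToL2_eq_multOp (φ : TestFun E G) : ∃ k : Lp ℂ 2 μ,
    testToL2 μ φ = multOp (resolvent (closedOp μ P)) (fun τ : ℝ => τ ^ 3) k ∧
    testToL2 μ (φ + diffOpTest P φ) = multOp (resolvent (closedOp μ P)) (fun τ : ℝ => τ ^ 2) k ∧
    testToL2 μ (diffOpTest P φ) =
      multOp (resolvent (closedOp μ P)) (fun τ : ℝ => τ ^ 2 * (1 - τ)) k := by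
  have hT := isInjectiveContraction_closedOp hess hpos
  have hr := resolvent_testToL2 hess hpos
  set T := resolvent (closedOp μ P)
  set φ₁ := φ + diffOpTest P φ with hφ₁
  set φ₂ := φ₁ + diffOpTest P φ₁
  set k := testToL2 μ (φ₂ + diffOpTest P φ₂)
  have hid : IsMultiplier fun τ => τ := .of_continuousOn (by fun_prop)
  have hsq : IsMultiplier fun τ => τ ^ 2 := .of_continuousOn (by fun_prop)
  have h2 : multOp T (fun τ => τ ^ 2) k = testToL2 μ φ₁ := by
    simp_rw [pow_two]
    rw [hT.multOp_mul hid hid, hT.multOp_id_apply, hT.multOp_id_apply, hr, hr]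
  refine ⟨k, ?_, h2.symm, ?_⟩
  · have h3 : (fun τ : ℝ => τ ^ 3) = fun τ => τ * τ ^ 2 := by ext τ; ring
    rw [h3, hT.multOp_mul hid hsq, h2, hT.multOp_id_apply, hr]
  · have h3 : (fun τ : ℝ => τ ^ 2 * (1 - τ)) = fun τ => (1 - τ) * τ ^ 2 := by ext τ; ring
    rw [h3, hT.multOp_mul (.of_continuousOn (by fun_prop)) hsq, h2, hT.multOp_one_sub_apply, hr,
      hφ₁, map_add, add_sub_cancel_left]

lemma isSolution_propagator {ν s : ℝ} (hν : 2 ≤ ν) (hs : 0 ≤ s) {u₀ u₁ : Dist E G}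
    {h₀ h₁ : Lp ℂ 2 μ} (H₀ : SobolevRep μ P ν s u₀ h₀) (H₁ : SobolevRep μ P ν (s - 1) u₁ h₁) :
    IsSolution μ P ν s u₀ u₁ fun t => distOfLp (resolventPow (closedOp μ P) (s / ν))
      (propagator (resolvent (closedOp μ P)) (1 / ν) h₀ h₁ t) := by
  have hT := isInjectiveContraction_closedOp hess hpos
  have hθ0 : 0 ≤ 1 / ν := by positivity
  have hθ : 1 / ν ≤ 1 / 2 := one_div_le_one_div_of_le (by norm_num) hν
  have hσ : 0 ≤ s / ν := by positivity
  have hσ1 : (s - 1) / ν = s / ν - 1 / ν := sub_div _ _ _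
  refine ⟨⟨_, continuousOn_propagator_add hT hθ0 hθ h₀ h₁, fun t _ =>
    (sobolevRep_iff_of_nonneg hess hpos hσ).mpr fun φ => rfl⟩, ?_, fun φ => ?_⟩
  · refine Dist.ext fun φ => ?_
    rw [(sobolevRep_iff_of_nonneg hess hpos hσ).mp H₀ φ, distOfLp_apply, propagator_zero hT]
  obtain ⟨k, hk3, hk2, hkR⟩ := exists_testToL2_eq_multOp hess hpos φ
  have h3 : IsMultiplier fun τ => τ ^ 3 := .of_continuousOn (by fun_prop)
  have hR : IsMultiplier fun τ => τ ^ 2 * (1 - τ) := .of_continuousOn (by fun_prop)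
  set T := resolvent (closedOp μ P)
  set x := resolventPow (closedOp μ P) (s / ν) k
  have hd : ∀ {f : ℝ → Lp ℂ 2 μ} {f' : Lp ℂ 2 μ} {t : ℝ}, HasDerivWithinAt f f' (Ici 0) t →
      HasDerivWithinAt (fun t => ⟪x, f t⟫_ℂ) ⟪x, f'⟫_ℂ (Ici 0) t := fun h =>
    ((innerSL ℂ x).restrictScalars ℝ).hasFDerivAt.comp_hasDerivWithinAt _ h
  have hD : ∀ t, 0 ≤ t → HasDerivWithinAt (fun t => ⟪x, propagatorDeriv T (1 / ν) h₀ h₁ t⟫_ℂ)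
      (-distOfLp (resolventPow (closedOp μ P) (s / ν)) (propagator T (1 / ν) h₀ h₁ t)
        (diffOpTest P φ) - ⟪x, propagatorDeriv T (1 / ν) h₀ h₁ t⟫_ℂ) (Ici 0) t := by
    intro t ht
    refine (hd (hasDerivWithinAt_cfc_propagatorDeriv hT hθ0 hθ h₀ h₁ ht)).congr_deriv ?_
    rw [distOfLp_apply, hkR, resolventPow_multOp hT hσ hR,
      hT.inner_multOp hR, inner_sub_right, inner_neg_right]
  refine ⟨fun t => ⟪x, propagatorDeriv T (1 / ν) h₀ h₁ t⟫_ℂ,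
    fun t ht => (hD t ht).continuousWithinAt, fun t ht => ?_, ?_,
    fun t ht => (hD t ht.le).hasDerivAt (Ici_mem_nhds ht)⟩
  · simp only [distOfLp_apply, hk3]
    have e : resolventPow (closedOp μ P) (s / ν) (multOp T (fun τ => τ ^ 3) k) =
        multOp T (fun τ => τ ^ 3) x := resolventPow_multOp hT hσ h3 k
    simp_rw [e, hT.inner_multOp h3]
    exact hd (hasDerivWithinAt_cfc_propagator hT hθ0 hθ h₀ h₁ ht)
  · have hp : 0 ≤ 1 + (s - 1) / ν := by rw [hσ1]; linarith
    have hP : ∀ q : ℝ, 0 ≤ q → IsMultiplier fun τ => τ ^ q :=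
      fun q hq => .of_continuousOn (Real.continuous_rpow_const hq).continuousOn
    have h4 := hP (3 - 1 / ν) (by linarith)
    rw [(sobolevRep_iff hess hpos (by rw [hσ1]; linarith)).mp H₁ φ, hk2]
    simp only
    rw [propagatorDeriv_zero hT, ← hT.inner_multOp h4]
    congr 1
    rw [resolventPow_eq_multOp hT hp, ← hT.multOp_mul (hP _ hp) (.of_continuousOn (by fun_prop)),
      ← resolventPow_multOp hT hσ h4, resolventPow_eq_multOp hT hσ, ← hT.multOp_mul (hP _ hσ) h4]
    refine congrArg (· k) (hT.multOp_congr fun τ hτ => ?_)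
    rw [← Real.rpow_natCast, ← Real.rpow_add hτ.1, ← Real.rpow_add hτ.1, hσ1]
    congr 1
    push_cast
    ring

end Solution

lemma le_mul_add_iInf {X : ℝ≥0∞} {ι : Type*} {p q : ι → Prop} {f : ι → ℝ≥0∞} {c a b : ℝ≥0∞}
    (hc : c ≠ 0) (hc' : c ≠ ⊤) (h : ∀ i, p i → ∀ j, q j → X ≤ c * ((a + f i) + (b + f j))) :
    X ≤ c * ((a + ⨅ (i) (_ : p i), f i) + (b + ⨅ (j) (_ : q j), f j)) := by
  simp only [ENNReal.add_iInf, ENNReal.iInf_add, ENNReal.mul_iInf_of_ne hc hc', le_iInf_iff]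
  exact fun j hj i hi => h i hi j hj

end GradedLie

end

theorem theorem1p1
    {E : Type*} [NormedAddCommGroup E] [NormedSpace ℝ E] [FiniteDimensional ℝ E]
    {G : Type*} [TopologicalSpace G] [ChartedSpace E G] [Group G] [LieGroup 𝓘(ℝ, E) ∞ G]
    [IsTopologicalGroup G] [SecondCountableTopology G] [T2Space G] [SimplyConnectedSpace G]
    [MeasurableSpace G] [BorelSpace G] (μ : Measure G) [μ.IsHaarMeasure]
    (V : ℕ → Submodule ℝ (GroupLieAlgebra 𝓘(ℝ, E) G)) (hV : GradedLie.IsGradation V)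
    (ν : ℝ) (hν : 2 ≤ ν) (P : FreeAlgebra ℂ (GroupLieAlgebra 𝓘(ℝ, E) G))
    (hR : GradedLie.IsRockland V ν P) (hpos : GradedLie.IsPositiveOp μ P)
    (hess : IsSelfAdjoint (GradedLie.closedOp μ P))
    (s γ : ℝ) (hs : 0 ≤ s) (hsγ : 0 ≤ s + γ) :
    ∃ C : NNReal, ∀ u₀ u₁ : GradedLie.Dist E G,
      GradedLie.interNorm μ P ν s (-γ) u₀ ≠ ⊤ →
      GradedLie.interNorm μ P ν (s - 1) (-γ) u₁ ≠ ⊤ →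
      ∃ u : ℝ → GradedLie.Dist E G,
        GradedLie.IsSolution μ P ν s u₀ u₁ u ∧
        (∀ v, GradedLie.IsSolution μ P ν s u₀ u₁ v → ∀ t, 0 ≤ t → v t = u t) ∧
        ∀ t, 0 ≤ t → GradedLie.homSobolevNorm μ P ν s s (u t) ≤
          C * ENNReal.ofReal ((1 + t) ^ (-((s + γ) / ν))) *
            (GradedLie.interNorm μ P ν s (-γ) u₀ +
              GradedLie.interNorm μ P ν (s - 1) (-γ) u₁) := by
  have hν0 : 0 < ν := by linarith
  have hσ : 0 ≤ s / ν := by positivity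
  have hp : 0 ≤ (s + γ) / ν := by positivity
  have hθ0 : 0 ≤ 1 / ν := by positivity
  have hθ : 1 / ν ≤ 1 / 2 := one_div_le_one_div_of_le (by norm_num) hν
  have hσ1 : -1 ≤ (s - 1) / ν := by rw [sub_div]; linarith
  have hT := GradedLie.isInjectiveContraction_closedOp hess hpos
  obtain ⟨C, hC0, hC⟩ := GradedLie.exists_rpow_mul_exp_le hp
  refine ⟨(2 ^ ((s + γ) / ν) * (2 * C)).toNNReal, fun u₀ u₁ hu₀ hu₁ => ?_⟩
  have hex : ∀ {σ : ℝ} {f : GradedLie.Dist E G}, GradedLie.interNorm μ P ν σ (-γ) f ≠ ⊤ →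
      ∃ h, GradedLie.SobolevRep μ P ν σ f h := by
    intro σ f hf
    by_contra! hne
    refine hf ?_
    simp [GradedLie.interNorm, GradedLie.sobolevNorm, hne]
  obtain ⟨h₀, H₀⟩ := hex hu₀
  obtain ⟨h₁, H₁⟩ := hex hu₁
  have hsol := GradedLie.isSolution_propagator hess hpos hν hs H₀ H₁
  refine ⟨_, hsol, fun v hv t ht => GradedLie.isSolution_unique hess hpos hσ hv hsol ht,
    fun t ht => ?_⟩
  set w := GradedLie.propagator (GradedLie.resolvent (GradedLie.closedOp μ P)) (1 / ν) h₀ h₁ t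
  set K : ℝ := 2 ^ ((s + γ) / ν) * (2 * C) with hK
  have hK0 : 0 < K := by positivity
  have ht1 : 0 < (1 + t) ^ (-((s + γ) / ν)) := Real.rpow_pos_of_pos (by linarith) _
  have hc : (K.toNNReal : ENNReal) * ENNReal.ofReal ((1 + t) ^ (-((s + γ) / ν))) =
      ENNReal.ofReal (K * (1 + t) ^ (-((s + γ) / ν))) := by
    rw [ENNReal.ofReal_mul hK0.le]
    rfl
  rw [hc]
  have hle : GradedLie.homSobolevNorm μ P ν s s
      (GradedLie.distOfLp (GradedLie.resolventPow (GradedLie.closedOp μ P) (s / ν)) w) ≤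
      ‖GradedLie.bddTransformPow (GradedLie.closedOp μ P) (s / ν) w‖ₑ := by
    refine iInf₂_le _ ⟨w, (GradedLie.sobolevRep_iff_of_nonneg hess hpos hσ).mpr fun φ => rfl, ?_⟩
    rw [neg_div]
    exact GradedLie.isPower_bddTransformPow hT hσ w
  -- The infimum defining each inhomogeneous norm runs over a single vector, by uniqueness.
  have hn₀ : ‖h₀‖ₑ ≤ GradedLie.sobolevNorm μ P ν s u₀ := le_iInf₂ fun h hh => by
    rw [GradedLie.sobolevRep_unique hess hpos (by linarith) H₀ hh]
  have hn₁ : ‖h₁‖ₑ ≤ GradedLie.sobolevNorm μ P ν (s - 1) u₁ := le_iInf₂ fun h hh => by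
    rw [GradedLie.sobolevRep_unique hess hpos hσ1 H₁ hh]
  have hmain : GradedLie.homSobolevNorm μ P ν s s
      (GradedLie.distOfLp (GradedLie.resolventPow (GradedLie.closedOp μ P) (s / ν)) w) ≤
      ENNReal.ofReal (K * (1 + t) ^ (-((s + γ) / ν))) *
        ((‖h₀‖ₑ + GradedLie.homSobolevNorm μ P ν s (-γ) u₀) +
          (‖h₁‖ₑ + GradedLie.homSobolevNorm μ P ν (s - 1) (-γ) u₁)) := by
    refine GradedLie.le_mul_add_iInf (ENNReal.ofReal_pos.mpr (by positivity)).ne'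
      ENNReal.ofReal_ne_top fun k₀ hk₀ k₁ hk₁ => hle.trans ?_
    obtain ⟨h, hh, hk₀⟩ := hk₀
    obtain rfl := GradedLie.sobolevRep_unique hess hpos (by linarith) H₀ hh
    obtain ⟨h, hh, hk₁⟩ := hk₁
    obtain rfl := GradedLie.sobolevRep_unique hess hpos hσ1 H₁ hh
    rw [neg_div ν γ] at hk₀ hk₁
    have hb₀ := GradedLie.norm_bddTransformPow_propagator_le hp hT hC0.le hC
      GradedLie.isAdmissible_one_zero hσ (add_div s γ ν) (by ring) hk₀ ht
    have hb₁ := GradedLie.norm_bddTransformPow_propagator_le hp hT hC0.le hC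
      (GradedLie.isAdmissible_zero_one hθ0 hθ) hσ (add_div s γ ν) (by ring) hk₁ ht
    have hb : ‖GradedLie.bddTransformPow (GradedLie.closedOp μ P) (s / ν) w‖ ≤
        K * (1 + t) ^ (-((s + γ) / ν)) * ((‖h₀‖ + ‖k₀‖) + (‖h₁‖ + ‖k₁‖)) := by
      rw [mul_add]
      refine le_trans ?_ (add_le_add hb₀ hb₁)
      simp only [w, GradedLie.propagator, map_add]
      exact norm_add_le _ _
    simp only [← ofReal_norm]
    rw [← ENNReal.ofReal_add (norm_nonneg _) (norm_nonneg _),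
      ← ENNReal.ofReal_add (norm_nonneg _) (norm_nonneg _),
      ← ENNReal.ofReal_add (by positivity) (by positivity), ← ENNReal.ofReal_mul (by positivity)]
    exact ENNReal.ofReal_le_ofReal hb
  refine hmain.trans ?_
  simp only [GradedLie.interNorm]
  gcongr
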